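/- Let $B$ be a standard Brownian motion on a probability space with (risk-neutral) measure $\mathbb{Q}$, let $r\in\mathbb{R}$, $\sigma,T,K>0$, and put $S_t=\exp\{(r-\tfrac12\sigma^2)t+\sigma B_t\}$ (geometric Brownian motion, $\mathrm{d}S_t=rS_t\,\mathrm{d}t+\sigma S_t\,\mathrm{d}B_t$, $S_0=1$), $A_T=\frac1T\int_0^TS_u\,\mathrm{d}u$ and $$\pi=e^{-rT}\,\mathbb{E}\big[(A_T-K)^+\big].$$ Let $\mu\in\mathbb{R}$, $\nu>0$, let $w(x)=\frac{1}{\sqrt{2\pi}\,\nu x}\exp\{-\frac{(\log x-\mu)^2}{2\nu^2}\}$ be the log-normal density on $(0,\infty)$, and write $\langle f,h\rangle_w=\int_0^\infty f(x)h(x)w(x)\,\mathrm{d}x$ and $\|f\|_w^2=\int_0^\infty f(x)^2w(x)\,\mathrm{d}x\in[0,\infty]$; $L^2_w$ is the set of measurable $f$ with $\|f\|_w<\infty$. Let $F(x)=e^{-rT}(x-K)^+$ be the discounted payoff function, let $g$ be the density of $A_T$, and let $\ell=g/w$ be the likelihood ratio. For $N\ge 0$ let $b_0,\dots,b_N$ be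 any basis, orthonormal for $\langle\cdot,\cdot\rangle_w$, of the space of real polynomials of degree at most $N$, and put $f_n=\langle F,b_n\rangle_w$, $\ell_n=\langle\ell,b_n\rangle_w$, $$\pi^{(N)}=\sum_{n=0}^Nf_n\ell_n,\qquad \epsilon_N^F=\Big\|F-\sum_{n=0}^Nf_nb_n\Big\|_w^2,\qquad \epsilon_N^\ell=\Big\|\ell-\sum_{n=0}^N\ell_nb_n\Big\|_w^2 .$$ These objects are well defined: $A_T$ has a density with respect to Lebesgue measure, $(A_T-K)^+$ is integrable, $F\in L^2_w$, and if $\nu^2>\tfrac12\sigma^2T$ then also $\ell\in L^2_w$ and $\epsilon_N^F,\epsilon_N^\ell<\infty$. For every $N\ge0$ the truncation error satisfies $$|\pi-\pi^{(N)}|\le\sqrt{\epsilon_N^F\,\epsilon_N^\ell},$$ where the right-hand side is read in $[0,\infty]$ if $\epsilon_N^\ell=\infty$. -/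

import Mathlib

open MeasureTheory ProbabilityTheory
open scoped NNReal ENNReal

noncomputable section

namespace AsianOption

/-- Geometric Brownian motion started at `1`, i.e. the solution
`S_t = exp ((r - σ² / 2) t + σ B_t)` of `dS_t = r S_t dt + σ S_t dB_t`, `S_0 = 1`. -/
def stockPrice {Ω : Type*} (B : ℝ≥0 → Ω → ℝ) (r σ : ℝ) (t : ℝ≥0) (ω : Ω) : ℝ :=
  Real.exp ((r - σ ^ 2 / 2) * (t : ℝ) + σ * B t ω)

/-- The continuous arithmetic average `A_T = (1 / T) ∫_0^T S_u du`. -/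
def avgPrice {Ω : Type*} (B : ℝ≥0 → Ω → ℝ) (r σ T : ℝ) (ω : Ω) : ℝ :=
  (1 / T) * ∫ u in (0 : ℝ)..T, stockPrice B r σ u.toNNReal ω

/-- The price at time `0` of the Asian option with strike `K` and expiry `T`,
`π = e^{-rT} E[(A_T - K)⁺]`. -/
def price {Ω : Type*} [MeasurableSpace Ω] (Q : Measure Ω) (B : ℝ≥0 → Ω → ℝ)
    (r σ T K : ℝ) : ℝ :=
  Real.exp (-r * T) * ∫ ω, max (avgPrice B r σ T ω - K) 0 ∂Q

/-- The log-normal density `w` with parameters `μ`, `ν` (only its values on `(0, ∞)` are used). -/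
def weight (μ ν x : ℝ) : ℝ :=
  1 / (Real.sqrt (2 * Real.pi) * ν * x) * Real.exp (-(Real.log x - μ) ^ 2 / (2 * ν ^ 2))

/-- The scalar product `⟨f, h⟩_w = ∫_0^∞ f(x) h(x) w(x) dx`. -/
def wInner (μ ν : ℝ) (f h : ℝ → ℝ) : ℝ :=
  ∫ x in Set.Ioi (0 : ℝ), f x * h x * weight μ ν x

/-- The squared norm `‖f‖_w² = ∫_0^∞ f(x)² w(x) dx`, as an element of `[0, ∞]`. -/
def wNormSq (μ ν : ℝ) (f : ℝ → ℝ) : ℝ≥0∞ :=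
  ∫⁻ x in Set.Ioi (0 : ℝ), ENNReal.ofReal (f x ^ 2 * weight μ ν x)

/-- `f ∈ L²_w`: the function `f` is measurable and has finite `L²_w`-norm. -/
def MemL2w (μ ν : ℝ) (f : ℝ → ℝ) : Prop :=
  Measurable f ∧ wNormSq μ ν f < ∞

/-- `b_0, …, b_N` is a basis of the space of polynomials of degree at most `N` that is orthonormal
in `L²_w`. (Linear independence follows from orthonormality.) -/
def IsOrthonormalPolyBasis (μ ν : ℝ) (N : ℕ) (b : Fin (N + 1) → Polynomial ℝ) : Prop :=
  Submodule.span ℝ (Set.range b) = Polynomial.degreeLE ℝ (N : WithBot ℕ) ∧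
    ∀ i j, wInner μ ν (fun x => (b i).eval x) (fun x => (b j).eval x) = if i = j then 1 else 0

/-- The discounted payoff function `F(x) = e^{-rT} (x - K)⁺`. -/
def payoff (r T K x : ℝ) : ℝ :=
  Real.exp (-r * T) * max (x - K) 0

/-- The likelihood ratio `ℓ = g / w`, where `g` is the density of the law of `A_T` with respect to
Lebesgue measure. -/
def likelihood {Ω : Type*} [MeasurableSpace Ω] (Q : Measure Ω) (B : ℝ≥0 → Ω → ℝ)
    (r σ T μ ν x : ℝ) : ℝ :=
  (pdf (avgPrice B r σ T) Q volume x).toReal / weight μ ν x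

/-- The polynomial `∑_{n ≤ N} ⟨f, b_n⟩_w b_n`, evaluated at `x`: the orthogonal projection of `f`
onto the polynomials of degree at most `N` when `b` is an orthonormal basis of that space. -/
def polyProj (μ ν : ℝ) {N : ℕ} (b : Fin (N + 1) → Polynomial ℝ) (f : ℝ → ℝ) (x : ℝ) : ℝ :=
  ∑ n, wInner μ ν f (fun y => (b n).eval y) * (b n).eval x

/-- The squared projection error `‖f - ∑_{n ≤ N} ⟨f, b_n⟩_w b_n‖_w²`. -/
def projError (μ ν : ℝ) {N : ℕ} (b : Fin (N + 1) → Polynomial ℝ) (f : ℝ → ℝ) : ℝ≥0∞ :=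
  wNormSq μ ν (fun x => f x - polyProj μ ν b f x)

/-- The truncated series `π^{(N)} = ∑_{n ≤ N} f_n ℓ_n` with `f_n = ⟨F, b_n⟩_w` and
`ℓ_n = ⟨ℓ, b_n⟩_w`. -/
def truncatedPrice {Ω : Type*} [MeasurableSpace Ω] (Q : Measure Ω) (B : ℝ≥0 → Ω → ℝ)
    (r σ T K μ ν : ℝ) {N : ℕ} (b : Fin (N + 1) → Polynomial ℝ) : ℝ :=
  ∑ n, wInner μ ν (payoff r T K) (fun x => (b n).eval x) *
    wInner μ ν (likelihood Q B r σ T μ ν) (fun x => (b n).eval x)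

end AsianOption

end

/-! Write `P` for the projection onto polynomials. Since `F` vanishes on `(-∞, 0]`, `π = ⟨F, ℓ⟩_w`.
Subtracting the coefficient sum leaves `⟨F - PF, ℓ - Pℓ⟩_w` (`wInner_sub_sum_eq`), and
Cauchy–Schwarz gives the error bound. If `ε^ℓ = ∞`, the bound is trivial provided `ε^F ≠ 0`, which
holds because `F` is not a polynomial on `(0, ∞)`.

The analytic content is that, for every `0 < c < 1 / (2σ²T)`, the density of `A_T` is at most `C exp
(-c log² x)` on `(0, ∞)` (`exists_map_avgPrice_le`). Then `g² / w` is integrable as soon as `c > 1 /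
(4ν²)`, and such a `c` exists exactly when `ν² > σ²T / 2`.

For this bound, replace `A_T` by a grid average, with constants independent of the grid. In `B_t =
(t/T) B_T + bridge` the bridge is independent of `Z = B_T`, so given the bridge the average is an
increasing function `φ` of `Z`. Smearing the Gaussian density over `[z, z + 1]` before changing
variables bounds the density at `x` by `e^σ E[exp (|Z|/T) / φ'(Z); x ≤ φ(Z) ≤ e^σ x]`
(`measure_mean_exp_shiftExponent_le`). On that event `log φ(Z)` is within `σ` of `log x`, and
convexity inequalities for means (`exists_exp_div_mean_le`) extract the factor `exp (-c log² x)`.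
What remains has bounded expectation, because `exp (d σ² B_t²)` is integrable for `t ≤ T` when `d σ²
T < 1/2`. Open sets carry the bound to the limit of the grids. -/

namespace AsianOption

/-! ### The log-normal weight and its `L²` space -/

lemma integrable_exp_neg_mul_sq_add_mul {c : ℝ} (hc : 0 < c) (m : ℝ) :
    Integrable (fun y : ℝ => Real.exp (-c * y ^ 2 + m * y)) := by
  have h := ((integrable_exp_neg_mul_sq hc).comp_sub_right (m / (2 * c))).const_mul
    (Real.exp (m ^ 2 / (4 * c)))
  refine h.congr (Filter.Eventually.of_forall fun y => ?_)
  simp only [← Real.exp_add]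
  congr 1
  field_simp
  ring

/-- The substitution `x = e^y` turns this into a Gaussian integral; the Jacobian raises `m` to `m +
1`. -/
lemma integrableOn_exp_neg_mul_log_sq_add {c : ℝ} (hc : 0 < c) (m : ℝ) :
    IntegrableOn (fun x => Real.exp (-c * Real.log x ^ 2 + m * Real.log x)) (Set.Ioi 0) := by
  rw [← Real.range_exp, ← Set.image_univ,
    integrableOn_image_iff_integrableOn_abs_deriv_smul MeasurableSet.univ
      (fun x _ => (Real.hasDerivAt_exp x).hasDerivWithinAt) Real.exp_injective.injOn,
    integrableOn_univ]
  refine (integrable_exp_neg_mul_sq_add_mul hc (m + 1)).congr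
    (Filter.Eventually.of_forall fun y => ?_)
  simp only [Real.log_exp, Real.abs_exp, smul_eq_mul, ← Real.exp_add]
  congr 1
  ring

lemma pow_eq_exp_log {x : ℝ} (hx : 0 < x) (k : ℕ) : x ^ k = Real.exp (k * Real.log x) := by
  rw [Real.exp_nat_mul, Real.exp_log hx]

lemma weight_eq {μ ν x : ℝ} (hx : 0 < x) (hν : 0 < ν) :
    weight μ ν x = (1 / (Real.sqrt (2 * Real.pi) * ν)) * Real.exp (-(μ ^ 2 / (2 * ν ^ 2))) *
      Real.exp (-(1 / (2 * ν ^ 2)) * Real.log x ^ 2 + (μ / ν ^ 2 - 1) * Real.log x) := by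
  have h1 : weight μ ν x = (1 / (Real.sqrt (2 * Real.pi) * ν)) *
      (Real.exp (-Real.log x) * Real.exp (-(Real.log x - μ) ^ 2 / (2 * ν ^ 2))) := by
    rw [Real.exp_neg, Real.exp_log hx, weight]
    field_simp
  rw [h1, mul_assoc, ← Real.exp_add, ← Real.exp_add]
  congr 2
  field_simp
  ring

lemma weight_pos {μ ν x : ℝ} (hx : 0 < x) (hν : 0 < ν) : 0 < weight μ ν x := by
  unfold weight
  have := Real.pi_pos
  positivity

@[fun_prop]
lemma measurable_weight (μ ν : ℝ) : Measurable (weight μ ν) := by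
  unfold weight
  fun_prop

lemma integrableOn_pow_mul_weight (μ : ℝ) {ν : ℝ} (hν : 0 < ν) (k : ℕ) :
    IntegrableOn (fun x => x ^ k * weight μ ν x) (Set.Ioi 0) := by
  have h := (integrableOn_exp_neg_mul_log_sq_add (c := 1 / (2 * ν ^ 2)) (by positivity)
    (k + (μ / ν ^ 2 - 1))).const_mul
      ((1 / (Real.sqrt (2 * Real.pi) * ν)) * Real.exp (-(μ ^ 2 / (2 * ν ^ 2))))
  refine IntegrableOn.congr_fun h (fun x hx => ?_) measurableSet_Ioi
  simp only [weight_eq (Set.mem_Ioi.1 hx) hν, pow_eq_exp_log (Set.mem_Ioi.1 hx) k]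
  rw [mul_left_comm, ← Real.exp_add]
  congr 2
  ring

/-- The measure on `(0, ∞)` with density `weight μ ν`. -/
noncomputable def weightMeasure (μ ν : ℝ) : Measure ℝ :=
  (volume.restrict (Set.Ioi 0)).withDensity (fun x => ENNReal.ofReal (weight μ ν x))

lemma integrable_weightMeasure_iff (μ : ℝ) {ν : ℝ} (hν : 0 < ν) (f : ℝ → ℝ) :
    Integrable f (weightMeasure μ ν) ↔
      IntegrableOn (fun x => f x * weight μ ν x) (Set.Ioi 0) := by
  unfold weightMeasure
  rw [integrable_withDensity_iff (by fun_prop) (by simp)]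
  refine integrableOn_congr_fun (fun x hx => ?_) measurableSet_Ioi
  simp only [ENNReal.toReal_ofReal (weight_pos (Set.mem_Ioi.1 hx) hν).le]

lemma integral_weightMeasure (μ : ℝ) {ν : ℝ} (hν : 0 < ν) (f : ℝ → ℝ) :
    ∫ x, f x ∂(weightMeasure μ ν) = ∫ x in Set.Ioi (0 : ℝ), f x * weight μ ν x := by
  unfold weightMeasure
  rw [integral_withDensity_eq_integral_toReal_smul (by fun_prop) (by simp)]
  refine setIntegral_congr_fun measurableSet_Ioi (fun x hx => ?_)
  simp only [ENNReal.toReal_ofReal (weight_pos (Set.mem_Ioi.1 hx) hν).le, smul_eq_mul, mul_comm]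

lemma wInner_eq (μ : ℝ) {ν : ℝ} (hν : 0 < ν) (f h : ℝ → ℝ) :
    wInner μ ν f h = ∫ x, f x * h x ∂(weightMeasure μ ν) := by
  rw [integral_weightMeasure μ hν, wInner]

lemma wNormSq_eq (μ ν : ℝ) {f : ℝ → ℝ} (hf : Measurable f) :
    wNormSq μ ν f = ∫⁻ x, ENNReal.ofReal (f x ^ 2) ∂(weightMeasure μ ν) := by
  unfold weightMeasure wNormSq
  rw [lintegral_withDensity_eq_lintegral_mul _ (by fun_prop) (by fun_prop)]
  refine lintegral_congr fun x => ?_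
  rw [ENNReal.ofReal_mul (sq_nonneg _), mul_comm]
  rfl

lemma wNormSq_lt_top_iff (μ ν : ℝ) {f : ℝ → ℝ} (hf : Measurable f) :
    wNormSq μ ν f < ∞ ↔ MemLp f 2 (weightMeasure μ ν) := by
  rw [memLp_two_iff_integrable_sq hf.aestronglyMeasurable, wNormSq_eq μ ν hf,
    ← hasFiniteIntegral_iff_ofReal (Filter.Eventually.of_forall fun x => sq_nonneg _)]
  exact ⟨fun h => ⟨(hf.pow_const 2).aestronglyMeasurable, h⟩, fun h => h.2⟩

lemma integrable_polynomial (μ : ℝ) {ν : ℝ} (hν : 0 < ν) (p : Polynomial ℝ) :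
    Integrable (fun x => p.eval x) (weightMeasure μ ν) := by
  simp_rw [Polynomial.eval_eq_sum_range]
  refine integrable_finsetSum _ fun i _ => Integrable.const_mul ?_ _
  rw [integrable_weightMeasure_iff μ hν]
  exact integrableOn_pow_mul_weight μ hν i

lemma memLp_polynomial (μ : ℝ) {ν : ℝ} (hν : 0 < ν) (p : Polynomial ℝ) :
    MemLp (fun x => p.eval x) 2 (weightMeasure μ ν) := by
  rw [memLp_two_iff_integrable_sq p.continuous.measurable.aestronglyMeasurable]
  exact (integrable_polynomial μ hν (p ^ 2)).congr
    (Filter.Eventually.of_forall fun x => Polynomial.eval_pow 2)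

lemma measurable_payoff (r T K : ℝ) : Measurable (payoff r T K) := by
  unfold payoff
  fun_prop

lemma memLp_payoff (r T : ℝ) {K : ℝ} (hK : 0 < K) (μ : ℝ) {ν : ℝ} (hν : 0 < ν) :
    MemLp (payoff r T K) 2 (weightMeasure μ ν) := by
  refine ((memLp_polynomial μ hν Polynomial.X).const_mul (Real.exp (-r * T))).mono
    (measurable_payoff r T K).aestronglyMeasurable (Filter.Eventually.of_forall fun x => ?_)
  simp only [payoff, Polynomial.eval_X, norm_mul, Real.norm_eq_abs]
  refine mul_le_mul_of_nonneg_left ?_ (abs_nonneg _)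
  rcases le_total (x - K) 0 with h | h
  · simp [max_eq_right h]
  · rw [max_eq_left h, abs_of_nonneg h]
    exact (sub_le_self x hK.le).trans (le_abs_self x)

/-! ### Polynomial projection and Cauchy–Schwarz -/

section Projection

variable {μ ν : ℝ} {N : ℕ} (b : Fin (N + 1) → Polynomial ℝ)

lemma polyProj_eq_eval (f : ℝ → ℝ) (x : ℝ) :
    polyProj μ ν b f x =
      (∑ n, Polynomial.C (wInner μ ν f (fun y => (b n).eval y)) * b n).eval x := by
  simp [polyProj, Polynomial.eval_finsetSum]

lemma measurable_sub_polyProj {f : ℝ → ℝ} (hf : Measurable f) :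
    Measurable (fun x => f x - polyProj μ ν b f x) := by
  simp_rw [polyProj_eq_eval]
  exact hf.sub (Polynomial.continuous _).measurable

lemma memLp_polyProj (hν : 0 < ν) (f : ℝ → ℝ) :
    MemLp (polyProj μ ν b f) 2 (weightMeasure μ ν) := by
  simpa only [← polyProj_eq_eval] using memLp_polynomial μ hν
    (∑ n, Polynomial.C (wInner μ ν f (fun y => (b n).eval y)) * b n)

/-- The projection is a polynomial, hence in `L²_w`, whatever its coefficients are, including
default values of divergent integrals. Adding it back recovers `f`. -/
lemma projError_lt_top_iff (hν : 0 < ν) {f : ℝ → ℝ} (hf : Measurable f) :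
    projError μ ν b f < ∞ ↔ MemLp f 2 (weightMeasure μ ν) := by
  rw [projError, wNormSq_lt_top_iff μ ν (measurable_sub_polyProj b hf)]
  refine ⟨fun h => ?_, fun h => h.sub (memLp_polyProj b hν f)⟩
  have := h.add (memLp_polyProj (μ := μ) b hν f)
  convert this using 1
  ext x
  simp

/-- Expanding the right side, both mixed terms and the product of projections equal the same
coefficient sum, by orthonormality. -/
lemma wInner_sub_sum_eq (hν : 0 < ν)
    (hb : ∀ i j, wInner μ ν (fun x => (b i).eval x) (fun x => (b j).eval x) = if i = j then 1 else 0)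
    {f h : ℝ → ℝ} (hf : MemLp f 2 (weightMeasure μ ν)) (hh : MemLp h 2 (weightMeasure μ ν)) :
    wInner μ ν f h -
        ∑ n, wInner μ ν f (fun x => (b n).eval x) * wInner μ ν h (fun x => (b n).eval x) =
      wInner μ ν (fun x => f x - polyProj μ ν b f x) (fun x => h x - polyProj μ ν b h x) := by
  have hP := fun n => memLp_polynomial μ hν (b n)
  have key : ∀ u v : ℝ → ℝ, MemLp u 2 (weightMeasure μ ν) →
      ∫ x, u x * polyProj μ ν b v x ∂(weightMeasure μ ν) =
        ∑ n, wInner μ ν v (fun y => (b n).eval y) * wInner μ ν u (fun y => (b n).eval y) := by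
    intro u v hu
    simp only [polyProj, Finset.mul_sum]
    rw [integral_finsetSum]
    · refine Finset.sum_congr rfl fun n _ => ?_
      rw [wInner_eq μ hν u, ← integral_const_mul]
      refine integral_congr_ae (Filter.Eventually.of_forall fun x => ?_)
      simp only
      ring
    · intro n _
      refine ((hu.integrable_mul (hP n)).const_mul (wInner μ ν v fun y => (b n).eval y)).congr
        (Filter.Eventually.of_forall fun x => ?_)
      simp only [Pi.mul_apply]
      ring
  have hproj : ∀ v : ℝ → ℝ, ∀ n,
      wInner μ ν (polyProj μ ν b v) (fun y => (b n).eval y) =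
        wInner μ ν v (fun y => (b n).eval y) := by
    intro v n
    have h1 := key _ v (hP n)
    rw [wInner_eq μ hν]
    simp_rw [mul_comm (polyProj μ ν b v _)]
    rw [h1]
    simp [hb n]
  have hPf := memLp_polyProj (μ := μ) b hν f
  have hPh := memLp_polyProj (μ := μ) b hν h
  rw [wInner_eq μ hν (fun x => f x - polyProj μ ν b f x)]
  have e : ∀ x, (f x - polyProj μ ν b f x) * (h x - polyProj μ ν b h x) =
      f x * h x - f x * polyProj μ ν b h x -
        (h x * polyProj μ ν b f x - polyProj μ ν b f x * polyProj μ ν b h x) := by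
    intro x
    ring
  simp_rw [e]
  have i1 : Integrable (fun x => f x * h x) (weightMeasure μ ν) := hf.integrable_mul hh
  have i2 : Integrable (fun x => f x * polyProj μ ν b h x) (weightMeasure μ ν) :=
    hf.integrable_mul hPh
  have i3 : Integrable (fun x => h x * polyProj μ ν b f x) (weightMeasure μ ν) :=
    hh.integrable_mul hPf
  have i4 : Integrable (fun x => polyProj μ ν b f x * polyProj μ ν b h x)
    (weightMeasure μ ν) := hPf.integrable_mul hPh
  have i12 : Integrable (fun x => f x * h x - f x * polyProj μ ν b h x) (weightMeasure μ ν) :=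
    i1.sub i2
  have i34 : Integrable (fun x => h x * polyProj μ ν b f x -
    polyProj μ ν b f x * polyProj μ ν b h x) (weightMeasure μ ν) := i3.sub i4
  rw [integral_sub i12 i34, integral_sub i1 i2, integral_sub i3 i4, key f h hf,
    key h f hh, key _ h hPf, wInner_eq μ hν f h]
  simp_rw [hproj f]
  simp_rw [mul_comm (wInner μ ν h _)]
  ring

lemma ofReal_abs_wInner_le (hν : 0 < ν) {f h : ℝ → ℝ} (hf : Measurable f) (hh : Measurable h) :
    ENNReal.ofReal |wInner μ ν f h| ≤ (wNormSq μ ν f * wNormSq μ ν h) ^ (1 / 2 : ℝ) := by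
  have hsq : ∀ u : ℝ → ℝ, Measurable u →
      wNormSq μ ν u = ∫⁻ x, ‖u x‖ₑ ^ (2 : ℝ) ∂(weightMeasure μ ν) := by
    intro u hu
    rw [wNormSq_eq μ ν hu]
    refine lintegral_congr fun x => ?_
    rw [← sq_abs, ENNReal.ofReal_pow (abs_nonneg _), Real.enorm_eq_ofReal_abs]
    norm_num
  rw [hsq f hf, hsq h hh, ENNReal.mul_rpow_of_nonneg _ _ (by norm_num), wInner_eq μ hν,
    ← Real.enorm_eq_ofReal_abs]
  refine (enorm_integral_le_lintegral_enorm _).trans ?_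
  simp_rw [enorm_mul]
  exact ENNReal.lintegral_mul_le_Lp_mul_Lq _ Real.HolderConjugate.two_two
    hf.enorm.aemeasurable hh.enorm.aemeasurable

/-- Excludes the product `0 * ∞ = 0` in the error bound. A polynomial equal to the payoff on `(0,
∞)` would vanish on `(0, K)`, hence identically, yet the payoff is positive at `K + 1`. -/
lemma projError_payoff_ne_zero (hν : 0 < ν) (r T : ℝ) {K : ℝ} (hK : 0 < K) :
    projError μ ν b (payoff r T K) ≠ 0 := by
  intro h0
  set p : Polynomial ℝ :=
    ∑ n, Polynomial.C (wInner μ ν (payoff r T K) (fun y => (b n).eval y)) * b n with hp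
  have hpe : ∀ x, polyProj μ ν b (payoff r T K) x = p.eval x := polyProj_eq_eval b _
  have hcont : Continuous (payoff r T K) := by unfold payoff; fun_prop
  rw [projError, wNormSq, lintegral_eq_zero_iff'] at h0
  · have h1 : (payoff r T K) =ᵐ[volume.restrict (Set.Ioi 0)] fun x => p.eval x := by
      filter_upwards [h0, ae_restrict_mem measurableSet_Ioi] with x hx hx0
      have hw := weight_pos (μ := μ) (Set.mem_Ioi.1 hx0) hν
      have h2 : (payoff r T K x - polyProj μ ν b (payoff r T K) x) ^ 2 * weight μ ν x ≤ 0 := by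
        simpa using hx
      have h3 : (payoff r T K x - polyProj μ ν b (payoff r T K) x) ^ 2 = 0 :=
        le_antisymm (nonpos_of_mul_nonpos_left h2 hw) (sq_nonneg _)
      rw [hpe] at h3
      exact sub_eq_zero.1 (pow_eq_zero_iff two_ne_zero |>.1 h3)
    have h2 : Set.EqOn (payoff r T K) (fun x => p.eval x) (Set.Ioi 0) :=
      Measure.eqOn_open_of_ae_eq h1 isOpen_Ioi hcont.continuousOn p.continuous.continuousOn
    have hp0 : p = 0 := by
      refine Polynomial.eq_zero_of_infinite_isRoot p ((Set.Ioo_infinite hK).mono fun x hx => ?_)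
      have := h2 (Set.mem_Ioi.2 hx.1)
      simp only [payoff] at this
      rw [max_eq_right (by linarith [hx.2]), mul_zero] at this
      exact this.symm
    have h4 := h2 (show K + 1 ∈ Set.Ioi (0 : ℝ) from Set.mem_Ioi.2 (by linarith))
    rw [hp0] at h4
    simp [payoff] at h4
  · exact (((measurable_sub_polyProj b hcont.measurable).pow_const 2).mul
      (measurable_weight μ ν)).ennreal_ofReal.aemeasurable

end Projection

end AsianOption

/-! ### Consequences of a log-Gaussian bound on the law -/

namespace AsianOption

/-- The measure on `(0, ∞)` with density `C * exp (-c * (log x) ^ 2)`. -/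
noncomputable def logGaussianMeasure (C c : ℝ) : Measure ℝ :=
  (volume.restrict (Set.Ioi 0)).withDensity
    (fun x => ENNReal.ofReal (C * Real.exp (-c * Real.log x ^ 2)))

lemma logGaussianMeasure_absolutelyContinuous (C c : ℝ) : logGaussianMeasure C c ≪ volume :=
  (withDensity_absolutelyContinuous _ _).trans Measure.restrict_le_self.absolutelyContinuous

lemma isFiniteMeasure_logGaussianMeasure (C : ℝ) {c : ℝ} (hc : 0 < c) :
    IsFiniteMeasure (logGaussianMeasure C c) := by
  refine isFiniteMeasure_withDensity_ofReal (Integrable.hasFiniteIntegral ?_)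
  simpa [IntegrableOn] using (integrableOn_exp_neg_mul_log_sq_add hc 0).const_mul C

lemma integrable_id_logGaussianMeasure {C c : ℝ} (hC : 0 ≤ C) (hc : 0 < c) :
    Integrable (fun x : ℝ => x) (logGaussianMeasure C c) := by
  rw [logGaussianMeasure, integrable_withDensity_iff (by fun_prop) (by simp)]
  refine IntegrableOn.congr_fun ((integrableOn_exp_neg_mul_log_sq_add hc 1).const_mul C)
    (fun x hx => ?_) measurableSet_Ioi
  have hx : 0 < x := hx
  rw [ENNReal.toReal_ofReal (by positivity), Real.exp_add, one_mul, Real.exp_log hx]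
  ring

section LawBound

variable {Ω : Type*} [MeasurableSpace Ω] {Q : Measure Ω} {A : Ω → ℝ}

lemma integrable_of_map_le (hA : AEMeasurable A Q) {C c : ℝ} (hC : 0 ≤ C) (hc : 0 < c)
    (h : Q.map A ≤ logGaussianMeasure C c) : Integrable A Q := by
  have h1 := (integrable_id_logGaussianMeasure hC hc).mono_measure h
  exact (integrable_map_measure (by fun_prop) hA).1 h1

variable [IsProbabilityMeasure Q]

lemma hasPDF_of_map_le (hA : AEMeasurable A Q) {C c : ℝ}
    (h : Q.map A ≤ logGaussianMeasure C c) : HasPDF A Q volume := by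
  rw [Real.hasPDF_iff_of_aemeasurable hA]
  exact h.absolutelyContinuous.trans (logGaussianMeasure_absolutelyContinuous C c)

lemma pdf_le_of_map_le (hA : AEMeasurable A Q) {C c : ℝ}
    (h : Q.map A ≤ logGaussianMeasure C c) :
    ∀ᵐ x ∂(volume.restrict (Set.Ioi (0 : ℝ))),
      pdf A Q volume x ≤ ENNReal.ofReal (C * Real.exp (-c * Real.log x ^ 2)) := by
  have := hasPDF_of_map_le hA h
  refine ae_le_of_forall_setLIntegral_le_of_sigmaFinite (measurable_pdf A Q volume)
    fun s hs _ => ?_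
  rw [Measure.restrict_restrict hs]
  calc ∫⁻ x in s ∩ Set.Ioi 0, pdf A Q volume x = Q.map A (s ∩ Set.Ioi 0) := by
        rw [map_eq_setLIntegral_pdf A Q volume (hs.inter measurableSet_Ioi)]
    _ ≤ logGaussianMeasure C c (s ∩ Set.Ioi 0) := h _
    _ = _ := by
        rw [logGaussianMeasure, withDensity_apply _ (hs.inter measurableSet_Ioi),
          Measure.restrict_restrict (hs.inter measurableSet_Ioi), Set.inter_assoc, Set.inter_self]

/-- In `log x`, the square contributes `-2c` and `1 / w` contributes `1 / (2ν²)` to the quadratic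
coefficient, so the condition on `c` makes the total negative. -/
lemma integrableOn_sq_div_weight (C μ : ℝ) {c ν : ℝ} (hν : 0 < ν) (hc : 1 / (4 * ν ^ 2) < c) :
    IntegrableOn (fun x => (C * Real.exp (-c * Real.log x ^ 2)) ^ 2 / weight μ ν x)
      (Set.Ioi 0) := by
  have hc' : 0 < 2 * c - 1 / (2 * ν ^ 2) := by
    have : 1 / (2 * ν ^ 2) = 2 * (1 / (4 * ν ^ 2)) := by field_simp; norm_num
    linarith
  have h := (integrableOn_exp_neg_mul_log_sq_add hc' (-(μ / ν ^ 2 - 1))).const_mul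
    (C ^ 2 / ((1 / (Real.sqrt (2 * Real.pi) * ν)) * Real.exp (-(μ ^ 2 / (2 * ν ^ 2)))))
  refine IntegrableOn.congr_fun h (fun x hx => ?_) measurableSet_Ioi
  rw [weight_eq (Set.mem_Ioi.1 hx) hν, mul_pow, ← Real.exp_nat_mul, mul_div_mul_comm,
    ← Real.exp_sub]
  congr 2
  push_cast
  ring

lemma wNormSq_pdf_div_weight_lt_top (hA : AEMeasurable A Q) (μ : ℝ) {C c ν : ℝ} (hC : 0 ≤ C)
    (hν : 0 < ν) (hc : 1 / (4 * ν ^ 2) < c) (h : Q.map A ≤ logGaussianMeasure C c) :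
    wNormSq μ ν (fun x => (pdf A Q volume x).toReal / weight μ ν x) < ∞ := by
  refine lt_of_le_of_lt (lintegral_mono_ae ?_) (integrableOn_sq_div_weight C μ hν hc).lintegral_lt_top
  filter_upwards [pdf_le_of_map_le hA h, ae_restrict_mem measurableSet_Ioi] with x hx hx0
  have hw := weight_pos (μ := μ) (Set.mem_Ioi.1 hx0) hν
  refine ENNReal.ofReal_le_ofReal ?_
  have h1 : (pdf A Q volume x).toReal ≤ C * Real.exp (-c * Real.log x ^ 2) :=
    ENNReal.toReal_le_of_le_ofReal (by positivity) hx
  have h2 : ((pdf A Q volume x).toReal / weight μ ν x) ^ 2 * weight μ ν x =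
      (pdf A Q volume x).toReal ^ 2 / weight μ ν x := by
    field_simp
  rw [h2]
  gcongr

/-- The weight cancels only on `(0, ∞)`; the vanishing of `f` elsewhere removes the rest of the
line. -/
lemma integral_comp_eq_wInner [HasPDF A Q volume] (μ : ℝ) {ν : ℝ} (hν : 0 < ν) {f : ℝ → ℝ}
    (hf : Measurable f) (hf0 : ∀ x ≤ 0, f x = 0) :
    ∫ ω, f (A ω) ∂Q = wInner μ ν f (fun x => (pdf A Q volume x).toReal / weight μ ν x) := by
  rw [← pdf.integral_pdf_smul (μ := volume) (X := A) hf.aestronglyMeasurable, wInner,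
    ← setIntegral_eq_integral_of_forall_compl_eq_zero (s := Set.Ioi (0 : ℝ))]
  · refine setIntegral_congr_fun measurableSet_Ioi fun x hx => ?_
    have hw := weight_pos (μ := μ) (Set.mem_Ioi.1 hx) hν
    simp only [smul_eq_mul]
    field_simp
  · intro x hx
    rw [hf0 x (not_lt.1 hx), smul_zero]

end LawBound

/-! ### The price as a scalar product -/

section Pricing

variable {Ω : Type*} [MeasurableSpace Ω] {Q : Measure Ω} {B : ℝ≥0 → Ω → ℝ}
  {r σ T : ℝ}

lemma measurable_likelihood (Q : Measure Ω) (B : ℝ≥0 → Ω → ℝ) (r σ T μ ν : ℝ) :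
    Measurable (likelihood Q B r σ T μ ν) := by
  unfold likelihood
  exact (measurable_pdf _ _ _).ennreal_toReal.div (measurable_weight μ ν)

lemma price_eq_wInner [HasPDF (avgPrice B r σ T) Q volume] {K : ℝ} (hK : 0 < K)
    [IsProbabilityMeasure Q] (μ : ℝ) {ν : ℝ} (hν : 0 < ν) :
    price Q B r σ T K = wInner μ ν (payoff r T K) (likelihood Q B r σ T μ ν) := by
  unfold likelihood
  rw [price, ← integral_const_mul, ← integral_comp_eq_wInner μ hν (measurable_payoff r T K)]
  · rfl
  · intro x hx
    rw [payoff, max_eq_right (by linarith), mul_zero]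

lemma ofReal_abs_price_sub_truncatedPrice_le [HasPDF (avgPrice B r σ T) Q volume] {K : ℝ}
    (hK : 0 < K) [IsProbabilityMeasure Q] {μ ν : ℝ} (hν : 0 < ν)
    {N : ℕ} {b : Fin (N + 1) → Polynomial ℝ} (hb : IsOrthonormalPolyBasis μ ν N b) :
    ENNReal.ofReal |price Q B r σ T K - truncatedPrice Q B r σ T K μ ν b| ≤
      (projError μ ν b (payoff r T K) * projError μ ν b (likelihood Q B r σ T μ ν)) ^
        (1 / 2 : ℝ) := by
  have hF := measurable_payoff r T K
  have hl := measurable_likelihood Q B r σ T μ ν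
  by_cases h : projError μ ν b (likelihood Q B r σ T μ ν) = ∞
  · rw [h, ENNReal.mul_top (projError_payoff_ne_zero b hν r T hK),
      ENNReal.top_rpow_of_pos (by norm_num)]
    exact le_top
  · rw [price_eq_wInner hK μ hν, truncatedPrice, wInner_sub_sum_eq b hν hb.2
      (memLp_payoff r T hK μ hν) ((projError_lt_top_iff b hν hl).1 (lt_top_iff_ne_top.2 h))]
    exact ofReal_abs_wInner_le hν (measurable_sub_polyProj b hF) (measurable_sub_polyProj b hl)

end Pricing

end AsianOption

/-! ### Convexity inequalities for means of exponentials -/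

namespace AsianOption

section MeanExp

variable {ι : Type*} [Fintype ι]

/-- The arithmetic mean of a finite family of reals. -/
noncomputable def mean (f : ι → ℝ) : ℝ := (∑ i, f i) / Fintype.card ι

lemma mean_mono {f g : ι → ℝ} (h : ∀ i, f i ≤ g i) : mean f ≤ mean g := by
  unfold mean
  gcongr
  exact h _

lemma mean_mul_left (a : ℝ) (f : ι → ℝ) : mean (fun i => a * f i) = a * mean f := by
  rw [mean, mean, ← Finset.mul_sum, mul_div_assoc]

lemma mean_add (f g : ι → ℝ) : mean (fun i => f i + g i) = mean f + mean g := by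
  rw [mean, mean, mean, Finset.sum_add_distrib, add_div]

lemma mean_nonneg {f : ι → ℝ} (h : ∀ i, 0 ≤ f i) : 0 ≤ mean f :=
  div_nonneg (Finset.sum_nonneg fun i _ => h i) (Nat.cast_nonneg _)

variable [Nonempty ι]

lemma mean_const (a : ℝ) : mean (fun _ : ι => a) = a := by
  have : (Fintype.card ι : ℝ) ≠ 0 := Nat.cast_ne_zero.2 Fintype.card_ne_zero
  simp [mean, this]

lemma mean_pos {f : ι → ℝ} (h : ∀ i, 0 < f i) : 0 < mean f :=
  div_pos (Finset.sum_pos (fun i _ => h i) Finset.univ_nonempty)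
    (Nat.cast_pos.2 Fintype.card_pos)

lemma map_mean_le {s : Set ℝ} {g : ℝ → ℝ} (hg : ConvexOn ℝ s g) {f : ι → ℝ} (hf : ∀ i, f i ∈ s) :
    g (mean f) ≤ mean (fun i => g (f i)) := by
  have hn : (0 : ℝ) < Fintype.card ι := Nat.cast_pos.2 Fintype.card_pos
  have h := hg.map_sum_le (t := Finset.univ) (w := fun _ : ι => (Fintype.card ι : ℝ)⁻¹) (p := f)
    (fun _ _ => by positivity) (by simp [hn.ne']) (fun i _ => hf i)
  simpa only [mean, smul_eq_mul, ← Finset.mul_sum, div_eq_inv_mul] using h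

lemma exp_mul_log_mean_exp_le_of_one_le {p : ℝ} (hp : 1 ≤ p) (X : ι → ℝ) :
    Real.exp (p * Real.log (mean fun i => Real.exp (X i))) ≤
      mean fun i => Real.exp (p * X i) := by
  have h := map_mean_le (convexOn_rpow hp) (f := fun i => Real.exp (X i))
    (fun i => (Real.exp_pos _).le)
  simp only [← Real.exp_mul] at h
  rw [Real.rpow_def_of_pos (mean_pos fun i => Real.exp_pos _)] at h
  simpa only [mul_comm p] using h

lemma mean_le_log_mean_exp (X : ι → ℝ) : mean X ≤ Real.log (mean fun i => Real.exp (X i)) := by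
  rw [Real.le_log_iff_exp_le (mean_pos fun i => Real.exp_pos _)]
  exact map_mean_le convexOn_exp fun i => Set.mem_univ _

lemma exp_mul_log_mean_exp_le_of_nonpos {p : ℝ} (hp : p ≤ 0) (X : ι → ℝ) :
    Real.exp (p * Real.log (mean fun i => Real.exp (X i))) ≤
      mean fun i => Real.exp (p * X i) := by
  calc Real.exp (p * Real.log (mean fun i => Real.exp (X i))) ≤ Real.exp (p * mean X) :=
        Real.exp_le_exp.2 (mul_le_mul_of_nonpos_left (mean_le_log_mean_exp X) hp)
    _ = Real.exp (mean fun i => p * X i) := by rw [mean_mul_left]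
    _ ≤ _ := map_mean_le convexOn_exp fun i => Set.mem_univ _

/-- With `p = 2cL`, `pL ≤ cL² + (cX² - pX + cL²)` style completion of the square reduces the claim
to `e^{pL} ≤ mean e^{pX}`. Jensen gives this for `p ≤ 0` and `p ≥ 1`; for `0 < p < 1`, `L` is so
small that `cL² ≤ 1 / (4c)`. -/
lemma exp_mul_sq_log_mean_exp_le {c : ℝ} (hc : 0 < c) (X : ι → ℝ) :
    Real.exp (c * Real.log (mean fun i => Real.exp (X i)) ^ 2) ≤
      Real.exp (1 / (4 * c)) + mean fun i => Real.exp (c * X i ^ 2) := by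
  set L := Real.log (mean fun i => Real.exp (X i)) with hL
  have hmean : 0 ≤ mean fun i => Real.exp (c * X i ^ 2) := mean_nonneg fun i => (Real.exp_pos _).le
  have key : Real.exp (2 * c * L * L) ≤ mean (fun i => Real.exp (2 * c * L * X i)) →
      Real.exp (c * L ^ 2) ≤ mean fun i => Real.exp (c * X i ^ 2) := by
    intro h
    calc Real.exp (c * L ^ 2) = Real.exp (-(c * L ^ 2)) * Real.exp (2 * c * L * L) := by
          rw [← Real.exp_add]
          congr 1
          ring
      _ ≤ Real.exp (-(c * L ^ 2)) * mean (fun i => Real.exp (2 * c * L * X i)) := by gcongr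
      _ = mean (fun i => Real.exp (-(c * L ^ 2)) * Real.exp (2 * c * L * X i)) :=
          (mean_mul_left _ _).symm
      _ ≤ _ := mean_mono fun i => by
          rw [← Real.exp_add, Real.exp_le_exp]
          nlinarith [mul_nonneg hc.le (sq_nonneg (X i - L))]
  rcases le_or_gt L 0 with h0 | h0
  · refine (key (exp_mul_log_mean_exp_le_of_nonpos ?_ X)).trans (by linarith [Real.exp_pos (1 / (4 * c))])
    nlinarith
  · rcases le_or_gt 1 (2 * c * L) with h1 | h1
    · exact (key (exp_mul_log_mean_exp_le_of_one_le h1 X)).trans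
        (by linarith [Real.exp_pos (1 / (4 * c))])
    · have : c * L ^ 2 ≤ 1 / (4 * c) := by
        rw [le_div_iff₀ (by positivity)]
        nlinarith [mul_pos hc h0]
      linarith [Real.exp_le_exp.2 this]

/-- Cauchy–Schwarz: `(mean s)² ≤ mean (s e^X) * mean (s e^{-X})`. The factor `4` comes from `mean s
≥ 1/2`. -/
lemma inv_mean_mul_exp_le {s : ι → ℝ} (hs : ∀ i, 0 < s i) (hs1 : ∀ i, s i ≤ 1)
    (hmean : 1 / 2 ≤ mean s) (X : ι → ℝ) :
    1 / mean (fun i => s i * Real.exp (X i)) ≤ 4 * mean fun i => Real.exp (-X i) := by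
  have hpos : 0 < mean (fun i => s i * Real.exp (X i)) :=
    mean_pos fun i => mul_pos (hs i) (Real.exp_pos _)
  have hn : (0 : ℝ) < Fintype.card ι := Nat.cast_pos.2 Fintype.card_pos
  have h := Finset.sum_sq_le_sum_mul_sum_of_sq_le_mul Finset.univ (r := s)
    (f := fun i => s i * Real.exp (X i)) (g := fun i => s i * Real.exp (-X i))
    (fun i _ => (mul_pos (hs i) (Real.exp_pos _)).le)
    (fun i _ => (mul_pos (hs i) (Real.exp_pos _)).le) (fun i _ => by
      refine le_of_eq ?_
      rw [Real.exp_neg]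
      field_simp)
  have h1 : mean s ^ 2 ≤ mean (fun i => s i * Real.exp (X i)) *
      mean (fun i => s i * Real.exp (-X i)) := by
    simp only [mean, div_pow, div_mul_div_comm, ← sq]
    gcongr
  have h2 : mean (fun i => s i * Real.exp (-X i)) ≤ mean fun i => Real.exp (-X i) :=
    mean_mono fun i => mul_le_of_le_one_left (Real.exp_pos _).le (hs1 i)
  rw [div_le_iff₀ hpos]
  nlinarith [mul_le_mul_of_nonneg_left h2 hpos.le]

end MeanExp

lemma exp_add_le_exp_add_exp {c d : ℝ} (hc : 0 < c) (hcd : c < d) (u v : ℝ) :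
    Real.exp (c * u + v) ≤ Real.exp (d * u) + Real.exp (d / (d - c) * v) := by
  have h0 : 0 < d - c := sub_pos.2 hcd
  have hd : 0 < d := hc.trans hcd
  rcases le_total (c * u + v) (d * u) with h | h
  · linarith [Real.exp_le_exp.2 h, Real.exp_pos (d / (d - c) * v)]
  · have : c * u + v ≤ d / (d - c) * v := by
      rw [div_mul_eq_mul_div, le_div_iff₀ h0]
      nlinarith
    linarith [Real.exp_le_exp.2 this, Real.exp_pos (d * u)]

lemma abs_le_mul_sq_add {δ : ℝ} (hδ : 0 < δ) (x : ℝ) : |x| ≤ δ * x ^ 2 + 1 / (4 * δ) := by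
  have h : δ * x ^ 2 + 1 / (4 * δ) - |x| = δ * (|x| - 1 / (2 * δ)) ^ 2 := by
    rw [← sq_abs x]
    field_simp
    ring
  nlinarith [mul_nonneg hδ.le (sq_nonneg (|x| - 1 / (2 * δ)))]

lemma mul_add_sq_le {c d : ℝ} (hcd : c < d) (u v : ℝ) :
    c * (u + v) ^ 2 ≤ d * u ^ 2 + c * d / (d - c) * v ^ 2 := by
  have h0 : 0 < d - c := sub_pos.2 hcd
  have h : d * u ^ 2 + c * d / (d - c) * v ^ 2 - c * (u + v) ^ 2 =
      ((d - c) * u - c * v) ^ 2 / (d - c) := by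
    field_simp
    ring
  have : 0 ≤ ((d - c) * u - c * v) ^ 2 / (d - c) := by positivity
  linarith

/-- The room between `c` and `d` is spent in two stages, through an intermediate `c₁`: passing from
`log x` to `L`, then absorbing the factors linear in the exponent, `|z|/T` and `-X i`. The constant
depends neither on the index type nor on `s`, `X`, `z`, `x`. -/
lemma exists_exp_div_mean_le {σ T c d : ℝ} (hσ : 0 < σ) (hT : 0 < T) (hc : 0 < c) (hcd : c < d) :
    ∃ C : ℝ, 0 ≤ C ∧ ∀ {ι : Type} [Fintype ι] [Nonempty ι] (s X : ι → ℝ) (z x : ℝ),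
      (∀ i, 0 < s i) → (∀ i, s i ≤ 1) → 1 / 2 ≤ mean s → 0 < x →
      x ≤ (mean fun i => Real.exp (X i)) → (mean fun i => Real.exp (X i)) ≤ Real.exp σ * x →
      Real.exp (|z| / T) / (mean fun i => σ * s i * Real.exp (X i)) ≤
        C * Real.exp (-c * Real.log x ^ 2) *
          (1 + (mean fun i => Real.exp (d * X i ^ 2)) + Real.exp (d * σ ^ 2 * z ^ 2)) := by
  obtain ⟨c₁, hc₁, hc₁d⟩ := exists_between hcd
  have h0 : 0 < c₁ := hc.trans hc₁
  have hd : 0 < d := hc.trans hcd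
  have hq : 0 < d / (d - c₁) := div_pos hd (sub_pos.2 hc₁d)
  set q := d / (d - c₁) with hq_def
  -- Chosen so that multiplication by `q` turns `δX` and `δZ` into half of `d` and half of `d σ²`;
  -- the exponential of the half-sum is then at most the sum of the exponentials.
  set δX := d / (2 * q) with hδX
  set δZ := d * σ ^ 2 / (2 * q) with hδZ
  have hδX0 : 0 < δX := by positivity
  have hδZ0 : 0 < δZ := by positivity
  set E := 1 / (4 * (δZ * T ^ 2)) + 1 / (4 * δX) with hE
  set C₀ := c * c₁ / (c₁ - c) * σ ^ 2 with hC₀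
  set M := Real.exp (1 / (4 * d)) with hM
  have hM1 : 1 ≤ M := Real.one_le_exp (by positivity)
  refine ⟨Real.exp C₀ * (4 / σ * (Real.exp E * (2 * M))), by positivity, ?_⟩
  intro ι _ _ s X z x hs hs1 hsm hx hxA hAx
  set A := mean fun i => Real.exp (X i) with hA
  set L := Real.log A with hL
  have hA0 : 0 < A := mean_pos fun i => Real.exp_pos _
  set Y := mean fun i => Real.exp (d * X i ^ 2) with hY
  have hY0 : 0 ≤ Y := mean_nonneg fun i => (Real.exp_pos _).le
  have hlog : (Real.log x - L) ^ 2 ≤ σ ^ 2 := by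
    have h1 : Real.log x ≤ L := Real.log_le_log hx hxA
    have h2 : L ≤ σ + Real.log x := by
      have := Real.log_le_log hA0 hAx
      rwa [Real.log_mul (Real.exp_pos _).ne' hx.ne', Real.log_exp] at this
    rw [sq_le_sq, abs_of_nonpos (by linarith), abs_of_pos hσ]
    linarith
  have h1 : 1 ≤ Real.exp C₀ * Real.exp (-c * Real.log x ^ 2) * Real.exp (c₁ * L ^ 2) := by
    rw [← Real.exp_add, ← Real.exp_add]
    refine Real.one_le_exp ?_
    have h2 := mul_add_sq_le hc₁ L (Real.log x - L)
    have h3 : c * c₁ / (c₁ - c) * (Real.log x - L) ^ 2 ≤ C₀ :=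
      mul_le_mul_of_nonneg_left hlog (div_nonneg (by positivity) (sub_pos.2 hc₁).le)
    rw [add_sub_cancel] at h2
    linarith
  have hterm : ∀ i, Real.exp (c₁ * L ^ 2) * (Real.exp (|z| / T) * Real.exp (-X i)) ≤
      Real.exp E * (Real.exp (d * L ^ 2) + Real.exp (d * σ ^ 2 * z ^ 2) +
        Real.exp (d * X i ^ 2)) := by
    intro i
    have hz : |z| / T ≤ δZ * z ^ 2 + 1 / (4 * (δZ * T ^ 2)) := by
      have := abs_le_mul_sq_add (δ := δZ * T ^ 2) (by positivity) (z / T)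
      rw [abs_div, abs_of_pos hT] at this
      refine this.trans (le_of_eq ?_)
      field_simp
    have hXi : -X i ≤ δX * X i ^ 2 + 1 / (4 * δX) :=
      (neg_le_abs _).trans (abs_le_mul_sq_add hδX0 _)
    have hw : Real.exp (q * (δZ * z ^ 2 + δX * X i ^ 2)) ≤
        Real.exp (d * σ ^ 2 * z ^ 2) + Real.exp (d * X i ^ 2) := by
      have e : q * (δZ * z ^ 2 + δX * X i ^ 2) =
          (d * σ ^ 2 * z ^ 2 + d * X i ^ 2) / 2 := by
        rw [hδX, hδZ]
        field_simp
      rw [e]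
      rcases le_total (d * σ ^ 2 * z ^ 2) (d * X i ^ 2) with h | h
      · have := Real.exp_le_exp.2
          (show (d * σ ^ 2 * z ^ 2 + d * X i ^ 2) / 2 ≤ d * X i ^ 2 by linarith)
        linarith [Real.exp_pos (d * σ ^ 2 * z ^ 2)]
      · have := Real.exp_le_exp.2
          (show (d * σ ^ 2 * z ^ 2 + d * X i ^ 2) / 2 ≤ d * σ ^ 2 * z ^ 2 by linarith)
        linarith [Real.exp_pos (d * X i ^ 2)]
    calc Real.exp (c₁ * L ^ 2) * (Real.exp (|z| / T) * Real.exp (-X i))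
        ≤ Real.exp E * Real.exp (c₁ * L ^ 2 + (δZ * z ^ 2 + δX * X i ^ 2)) := by
          rw [← Real.exp_add, ← Real.exp_add, ← Real.exp_add, Real.exp_le_exp]
          linarith
      _ ≤ Real.exp E * (Real.exp (d * L ^ 2) + Real.exp (q * (δZ * z ^ 2 + δX * X i ^ 2))) := by
          gcongr
          exact exp_add_le_exp_add_exp h0 hc₁d _ _
      _ ≤ _ := by
          rw [add_assoc (Real.exp (d * L ^ 2))]
          gcongr
  have hD : Real.exp (c₁ * L ^ 2) * (Real.exp (|z| / T) *
      (1 / mean fun i => s i * Real.exp (X i))) ≤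
      4 * (Real.exp E * (2 * M)) * (1 + Y + Real.exp (d * σ ^ 2 * z ^ 2)) := by
    calc _ ≤ Real.exp (c₁ * L ^ 2) * (Real.exp (|z| / T) *
          (4 * mean fun i => Real.exp (-X i))) := by
          gcongr
          exact inv_mean_mul_exp_le hs hs1 hsm X
      _ = 4 * mean (fun i => Real.exp (c₁ * L ^ 2) * (Real.exp (|z| / T) * Real.exp (-X i))) := by
          rw [mean_mul_left, mean_mul_left]
          ring
      _ ≤ 4 * mean (fun i => Real.exp E * (Real.exp (d * L ^ 2) +
            Real.exp (d * σ ^ 2 * z ^ 2) + Real.exp (d * X i ^ 2))) := by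
          gcongr
          exact mean_mono hterm
      _ = 4 * (Real.exp E * (Real.exp (d * L ^ 2) + Real.exp (d * σ ^ 2 * z ^ 2) + Y)) := by
          rw [mean_mul_left, mean_add, mean_const]
      _ ≤ 4 * (Real.exp E * (M + Y + Real.exp (d * σ ^ 2 * z ^ 2) + Y)) := by
          gcongr
          exact exp_mul_sq_log_mean_exp_le hd X
      _ ≤ _ := by
          rw [mul_assoc 4, mul_assoc (Real.exp E)]
          gcongr
          nlinarith [mul_nonneg (sub_nonneg.2 hM1) hY0,
            mul_nonneg (sub_nonneg.2 hM1) (Real.exp_pos (d * σ ^ 2 * z ^ 2)).le,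
            Real.exp_pos (d * σ ^ 2 * z ^ 2)]
  have hDeq : Real.exp (|z| / T) / (mean fun i => σ * s i * Real.exp (X i)) =
      1 / σ * (Real.exp (|z| / T) * (1 / mean fun i => s i * Real.exp (X i))) := by
    simp_rw [mul_assoc σ]
    rw [mean_mul_left]
    field_simp
  have hpos : 0 ≤ Real.exp (|z| / T) * (1 / mean fun i => s i * Real.exp (X i)) :=
    mul_nonneg (Real.exp_pos _).le (one_div_nonneg.2
      (mean_nonneg fun i => (mul_pos (hs i) (Real.exp_pos _)).le))
  rw [hDeq]
  calc _ ≤ 1 / σ * ((Real.exp C₀ * Real.exp (-c * Real.log x ^ 2) * Real.exp (c₁ * L ^ 2)) *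
        (Real.exp (|z| / T) * (1 / mean fun i => s i * Real.exp (X i)))) :=
        mul_le_mul_of_nonneg_left (le_mul_of_one_le_left hpos h1) (by positivity)
    _ = Real.exp C₀ * Real.exp (-c * Real.log x ^ 2) * (1 / σ) * (Real.exp (c₁ * L ^ 2) *
        (Real.exp (|z| / T) * (1 / mean fun i => s i * Real.exp (X i)))) := by ring
    _ ≤ Real.exp C₀ * Real.exp (-c * Real.log x ^ 2) * (1 / σ) *
        (4 * (Real.exp E * (2 * M)) * (1 + Y + Real.exp (d * σ ^ 2 * z ^ 2))) := by gcongr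
    _ = _ := by ring

end AsianOption

/-! ### Densities of increasing functions of a Gaussian variable -/

namespace AsianOption

lemma gaussianPDF_le_mul_exp {v : ℝ≥0} (hv : v ≠ 0) {z y : ℝ} (h₁ : z ≤ y) (h₂ : y ≤ z + 1) :
    gaussianPDF 0 v z ≤ ENNReal.ofReal (Real.exp (|y| / v)) * gaussianPDF 0 v y := by
  have hv0 : (0 : ℝ) < v := NNReal.coe_pos.2 (pos_iff_ne_zero.2 hv)
  rw [gaussianPDF, gaussianPDF, ← ENNReal.ofReal_mul (Real.exp_pos _).le]
  refine ENNReal.ofReal_le_ofReal ?_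
  rw [gaussianPDFReal, gaussianPDFReal, mul_left_comm, ← Real.exp_add]
  gcongr
  have h : -(y - 0) ^ 2 / (2 * v) + |y| / v - -(z - 0) ^ 2 / (2 * v) =
      (z ^ 2 - y ^ 2 + 2 * |y|) / (2 * v) := by
    field_simp
    ring
  have h' : 0 ≤ (z ^ 2 - y ^ 2 + 2 * |y|) / (2 * v) := by
    refine div_nonneg ?_ (by positivity)
    nlinarith [mul_le_mul_of_nonneg_left (le_abs_self y) (sub_nonneg.2 h₁), abs_nonneg y,
      mul_nonneg (sub_nonneg.2 h₂) (abs_nonneg y)]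
  linarith

/-- An upper bound for the probability that an increasing function `φ` of a centred Gaussian
variable lies in `S`, which does not involve the inverse of `φ`. -/
lemma gaussianReal_preimage_le {v : ℝ≥0} (hv : v ≠ 0) {φ φ' : ℝ → ℝ} {κ : ℝ}
    (hφ : ∀ z, HasDerivAt φ (φ' z) z) (hφ'm : Measurable φ') (hpos : ∀ z, 0 < φ z)
    (hpos' : ∀ z, 0 < φ' z)
    (hκ : ∀ z y, z ≤ y → y ≤ z + 1 → φ y ≤ κ * φ z)
    (hκ' : ∀ z y, z ≤ y → y ≤ z + 1 → φ' y ≤ κ * φ' z)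
    {S : Set ℝ} (hS : MeasurableSet S) :
    gaussianReal 0 v (φ ⁻¹' S) ≤ ENNReal.ofReal κ * ∫⁻ x in S ∩ Set.Ioi 0,
      ∫⁻ y, {y | x ≤ φ y ∧ φ y ≤ κ * x}.indicator
        (fun y => ENNReal.ofReal (Real.exp (|y| / v) / φ' y)) y ∂(gaussianReal 0 v) := by
  have hκ0 : 0 < κ := by
    by_contra h
    have h1 := hκ 0 0 le_rfl (by norm_num)
    nlinarith [hpos 0]
  have hmono : StrictMono φ := strictMono_of_hasDerivAt_pos hφ hpos'
  have hφm : Measurable φ := hmono.monotone.measurable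
  set k : ℝ → ℝ≥0∞ := fun x => ∫⁻ y, {y | x ≤ φ y ∧ φ y ≤ κ * x}.indicator
        (fun y => ENNReal.ofReal (Real.exp (|y| / v) / φ' y)) y ∂(gaussianReal 0 v) with hk
  have hset : ∀ x, MeasurableSet {y | x ≤ φ y ∧ φ y ≤ κ * x} := fun x =>
    (measurableSet_le measurable_const hφm).inter (measurableSet_le hφm measurable_const)
  have hfm : Measurable fun y => ENNReal.ofReal (Real.exp (|y| / v) / φ' y) := by fun_prop
  -- Average the constant `gaussianPDF 0 v z` over `y ∈ [z, z + 1]`, then move the density and the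
  -- derivative from `z` to `y` at the cost of `exp (|y| / v)` and `κ`. The quotient by `φ' y`
  -- becomes a Gaussian expectation.
  have hpt : ∀ z, gaussianPDF 0 v z ≤
      ENNReal.ofReal |φ' z| * (ENNReal.ofReal κ * k (φ z)) := by
    intro z
    rw [← mul_assoc, ← ENNReal.ofReal_mul (abs_nonneg _), hk, abs_of_pos (hpos' z)]
    simp only
    rw [gaussianReal_of_var_ne_zero 0 hv,
      lintegral_withDensity_eq_lintegral_mul _ (measurable_gaussianPDF 0 v)
        (hfm.indicator (hset _)),
      ← lintegral_const_mul _ ((measurable_gaussianPDF 0 v).mul (hfm.indicator (hset _)))]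
    calc gaussianPDF 0 v z = ∫⁻ _ in Set.Icc z (z + 1), gaussianPDF 0 v z := by simp
      _ ≤ ∫⁻ y in Set.Icc z (z + 1), ENNReal.ofReal (φ' z * κ) *
          (gaussianPDF 0 v * {y | φ z ≤ φ y ∧ φ y ≤ κ * φ z}.indicator
            fun y => ENNReal.ofReal (Real.exp (|y| / v) / φ' y)) y := by
          refine setLIntegral_mono' measurableSet_Icc fun y hy => ?_
          have hmem : y ∈ {y | φ z ≤ φ y ∧ φ y ≤ κ * φ z} :=
            ⟨hmono.monotone hy.1, hκ z y hy.1 hy.2⟩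
          rw [Pi.mul_apply, Set.indicator_of_mem hmem, mul_left_comm,
            ← ENNReal.ofReal_mul (mul_pos (hpos' z) hκ0).le, mul_comm]
          refine (gaussianPDF_le_mul_exp hv hy.1 hy.2).trans ?_
          gcongr
          rw [← mul_div_assoc, le_div_iff₀ (hpos' y), mul_comm]
          gcongr
          rw [mul_comm]
          exact hκ' z y hy.1 hy.2
      _ ≤ _ := setLIntegral_le_lintegral _ _
  calc gaussianReal 0 v (φ ⁻¹' S) = ∫⁻ z in φ ⁻¹' S, gaussianPDF 0 v z := by
        rw [gaussianReal_of_var_ne_zero 0 hv, withDensity_apply _ (hφm hS)]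
    _ ≤ ∫⁻ z in φ ⁻¹' S, ENNReal.ofReal |φ' z| * (ENNReal.ofReal κ * k (φ z)) :=
        lintegral_mono hpt
    _ = ∫⁻ x in φ '' (φ ⁻¹' S), ENNReal.ofReal κ * k x :=
        (lintegral_image_eq_lintegral_abs_deriv_mul (hφm hS)
          (fun z _ => (hφ z).hasDerivWithinAt) hmono.injective.injOn
          (fun x => ENNReal.ofReal κ * k x)).symm
    _ ≤ ∫⁻ x in S ∩ Set.Ioi 0, ENNReal.ofReal κ * k x := by
        refine lintegral_mono_set ?_
        rintro _ ⟨z, hz, rfl⟩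
        exact ⟨hz, hpos z⟩
    _ = _ := lintegral_const_mul' _ _ ENNReal.ofReal_ne_top

/-! ### Conditioning on an independent family -/

section IndependentShift

variable {ι : Type*}

/-- The exponents `α i + σ * (s i * z + b i)`. -/
def shiftExponent (σ : ℝ) (α s : ι → ℝ) (z : ℝ) (b : ι → ℝ) (i : ι) : ℝ :=
  α i + σ * (s i * z + b i)

variable {σ : ℝ} {α s : ι → ℝ}

lemma shiftExponent_le_add (hσ : 0 < σ) (hs1 : ∀ i, s i ≤ 1) (b : ι → ℝ)
    {z y : ℝ} (h₁ : z ≤ y) (h₂ : y ≤ z + 1) (i : ι) :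
    shiftExponent σ α s y b i ≤ σ + shiftExponent σ α s z b i := by
  unfold shiftExponent
  have h : s i * (y - z) ≤ 1 := by nlinarith [hs1 i]
  nlinarith

variable [Fintype ι]

lemma mean_mul_exp_shiftExponent_le (hσ : 0 < σ) (hs1 : ∀ i, s i ≤ 1)
    (b : ι → ℝ) {z y : ℝ} (h₁ : z ≤ y) (h₂ : y ≤ z + 1) {u : ι → ℝ} (hu : ∀ i, 0 ≤ u i) :
    mean (fun i => u i * Real.exp (shiftExponent σ α s y b i)) ≤
      Real.exp σ * mean (fun i => u i * Real.exp (shiftExponent σ α s z b i)) := by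
  rw [← mean_mul_left]
  refine mean_mono fun i => ?_
  rw [mul_left_comm, ← Real.exp_add]
  exact mul_le_mul_of_nonneg_left
    (Real.exp_le_exp.2 (shiftExponent_le_add hσ hs1 b h₁ h₂ i)) (hu i)

lemma hasDerivAt_mean_exp_shiftExponent (b : ι → ℝ) (z : ℝ) :
    HasDerivAt (fun z => mean fun i => Real.exp (shiftExponent σ α s z b i))
      (mean fun i => σ * s i * Real.exp (shiftExponent σ α s z b i)) z := by
  unfold mean
  refine HasDerivAt.div_const (HasDerivAt.fun_sum fun i _ => ?_) _
  have h : HasDerivAt (fun z => shiftExponent σ α s z b i) (σ * s i) z := by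
    simpa [shiftExponent] using
      ((((hasDerivAt_id z).const_mul (s i)).add_const (b i)).const_mul σ).const_add (α i)
  simpa [mul_comm] using h.exp

lemma measurable_mean_mul_exp_shiftExponent (u : ι → ℝ) :
    Measurable fun p : ℝ × (ι → ℝ) =>
      mean fun i => u i * Real.exp (shiftExponent σ α s p.1 p.2 i) := by
  unfold mean shiftExponent
  fun_prop

variable [Nonempty ι] {Ω : Type*} [MeasurableSpace Ω] {Q : Measure Ω} [IsProbabilityMeasure Q]

/-- Freeze `β = b`, apply `gaussianReal_preimage_le` in `z`, and integrate over `b` by Tonelli.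
There `κ = e^σ` works since `s i ≤ 1`: a unit step in `z` raises each exponent by at most `σ`. -/
lemma measure_mean_exp_shiftExponent_le {v : ℝ≥0} (hv : v ≠ 0) (hσ : 0 < σ)
    (hs : ∀ i, 0 < s i) (hs1 : ∀ i, s i ≤ 1) {Z : Ω → ℝ} {β : Ω → ι → ℝ}
    (hZ : HasLaw Z (gaussianReal 0 v) Q) (hβ : AEMeasurable β Q) (hind : IndepFun Z β Q)
    {S : Set ℝ} (hS : MeasurableSet S) :
    Q {ω | (mean fun i => Real.exp (shiftExponent σ α s (Z ω) (β ω) i)) ∈ S} ≤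
      ENNReal.ofReal (Real.exp σ) * ∫⁻ x in S ∩ Set.Ioi 0, ∫⁻ ω,
        {ω | x ≤ (mean fun i => Real.exp (shiftExponent σ α s (Z ω) (β ω) i)) ∧
          (mean fun i => Real.exp (shiftExponent σ α s (Z ω) (β ω) i)) ≤
            Real.exp σ * x}.indicator
          (fun ω => ENNReal.ofReal (Real.exp (|Z ω| / v) /
            mean fun i => σ * s i * Real.exp (shiftExponent σ α s (Z ω) (β ω) i))) ω ∂Q := by
  set Φ : ℝ × (ι → ℝ) → ℝ := fun p =>
    mean fun i => Real.exp (shiftExponent σ α s p.1 p.2 i) with hΦ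
  set D : ℝ × (ι → ℝ) → ℝ := fun p =>
    mean fun i => σ * s i * Real.exp (shiftExponent σ α s p.1 p.2 i) with hD
  have hΦm : Measurable Φ := by
    simpa using measurable_mean_mul_exp_shiftExponent (σ := σ) (α := α) (s := s) (fun _ => 1)
  have hDm : Measurable D := measurable_mean_mul_exp_shiftExponent _
  have hZβ : AEMeasurable (fun ω => (Z ω, β ω)) Q := hZ.aemeasurable.prodMk hβ
  have hlaw : Q.map (fun ω => (Z ω, β ω)) = (gaussianReal 0 v).prod (Q.map β) := by
    rw [(indepFun_iff_map_prod_eq_prod_map_map hZ.aemeasurable hβ).1 hind, hZ.map_eq]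
  have : IsProbabilityMeasure (Q.map β) := Measure.isProbabilityMeasure_map hβ
  set J : ℝ → ℝ × (ι → ℝ) → ℝ≥0∞ := fun x =>
    {p | x ≤ Φ p ∧ Φ p ≤ Real.exp σ * x}.indicator
      (fun p => ENNReal.ofReal (Real.exp (|p.1| / v) / D p)) with hJ
  have hJm : Measurable (fun q : ℝ × (ℝ × (ι → ℝ)) => J q.1 q.2) := by
    have hset : MeasurableSet {q : ℝ × (ℝ × (ι → ℝ)) | q.1 ≤ Φ q.2 ∧
        Φ q.2 ≤ Real.exp σ * q.1} :=
      (measurableSet_le measurable_fst (hΦm.comp measurable_snd)).inter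
        (measurableSet_le (hΦm.comp measurable_snd) (measurable_fst.const_mul _))
    have hf : Measurable (fun q : ℝ × (ℝ × (ι → ℝ)) =>
      ENNReal.ofReal (Real.exp (|q.2.1| / v) / D q.2)) := by fun_prop
    exact hf.indicator hset
  have hJx : ∀ x, Measurable (J x) := fun x => hJm.comp measurable_prodMk_left
  have hpos : ∀ z b, 0 < Φ (z, b) := fun z b => mean_pos fun i => Real.exp_pos _
  have hposD : ∀ z b, 0 < D (z, b) := fun z b =>
    mean_pos fun i => mul_pos (mul_pos hσ (hs i)) (Real.exp_pos _)
  have hSm : MeasurableSet {p : (ι → ℝ) × ℝ | Φ (p.2, p.1) ∈ S} :=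
    (hΦm.comp measurable_swap) hS
  calc Q {ω | Φ (Z ω, β ω) ∈ S}
      = (Q.map β).prod (gaussianReal 0 v) {p | Φ (p.2, p.1) ∈ S} := by
        rw [← Measure.prod_swap, ← hlaw, Measure.map_apply measurable_swap hSm,
          Measure.map_apply_of_aemeasurable hZβ (measurable_swap hSm)]
        rfl
    _ = ∫⁻ b, gaussianReal 0 v ((fun z => Φ (z, b)) ⁻¹' S) ∂(Q.map β) :=
        Measure.prod_apply hSm
    _ ≤ ∫⁻ b, ENNReal.ofReal (Real.exp σ) *
          (∫⁻ x in S ∩ Set.Ioi 0, ∫⁻ z, J x (z, b) ∂(gaussianReal 0 v)) ∂(Q.map β) := by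
        refine lintegral_mono fun b => ?_
        refine gaussianReal_preimage_le hv (φ := fun z => Φ (z, b)) (φ' := fun z => D (z, b))
          (fun z => hasDerivAt_mean_exp_shiftExponent b z) (by fun_prop) (fun z => hpos z b)
          (fun z => hposD z b) (fun z y h₁ h₂ => ?_) (fun z y h₁ h₂ => ?_) hS
        · simpa using mean_mul_exp_shiftExponent_le (α := α) hσ hs1 b h₁ h₂
            (u := fun _ => 1) (fun _ => zero_le_one)
        · exact mean_mul_exp_shiftExponent_le hσ hs1 b h₁ h₂
            fun i => (mul_pos hσ (hs i)).le
    _ = ENNReal.ofReal (Real.exp σ) *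
          ∫⁻ b, (∫⁻ x in S ∩ Set.Ioi 0, ∫⁻ z, J x (z, b) ∂(gaussianReal 0 v)) ∂(Q.map β) :=
        lintegral_const_mul' _ _ ENNReal.ofReal_ne_top
    _ = ENNReal.ofReal (Real.exp σ) *
          ∫⁻ x in S ∩ Set.Ioi 0, ∫⁻ b, ∫⁻ z, J x (z, b) ∂(gaussianReal 0 v) ∂(Q.map β) := by
        congr 1
        refine lintegral_lintegral_swap (Measurable.aemeasurable ?_)
        exact Measurable.lintegral_prod_right' (f := fun q : ((ι → ℝ) × ℝ) × ℝ =>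
          J q.1.2 (q.2, q.1.1)) (hJm.comp (by fun_prop :
            Measurable fun q : ((ι → ℝ) × ℝ) × ℝ => (q.1.2, (q.2, q.1.1))))
    _ = ENNReal.ofReal (Real.exp σ) * ∫⁻ x in S ∩ Set.Ioi 0, ∫⁻ ω, J x (Z ω, β ω) ∂Q := by
        congr 1
        refine lintegral_congr fun x => ?_
        rw [← lintegral_map' (hJx x).aemeasurable hZβ, hlaw,
          lintegral_prod_symm _ (hJx x).aemeasurable]

end IndependentShift

end AsianOption

/-! ### Gaussian moments, Riemann sums and the grid approximation -/

namespace AsianOption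

section GaussianMoments

lemma integrable_exp_mul_sq_gaussianReal_one {k : ℝ} (hk : k < 1 / 2) :
    Integrable (fun x => Real.exp (k * x ^ 2)) (gaussianReal 0 1) := by
  rw [gaussianReal_of_var_ne_zero 0 one_ne_zero,
    integrable_withDensity_iff (measurable_gaussianPDF 0 1) (by simp [gaussianPDF])]
  have h := (integrable_exp_neg_mul_sq (sub_pos.2 hk)).const_mul (Real.sqrt (2 * Real.pi))⁻¹
  refine h.congr (Filter.Eventually.of_forall fun x => ?_)
  simp only [toReal_gaussianPDF, gaussianPDFReal, NNReal.coe_one, mul_one, sub_zero]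
  rw [mul_left_comm, ← Real.exp_add]
  congr 2
  ring

lemma gaussianReal_eq_map_sqrt_mul (v : ℝ≥0) :
    gaussianReal 0 v = (gaussianReal 0 1).map (fun x => Real.sqrt v * x) := by
  rw [gaussianReal_map_const_mul, mul_zero, mul_one]
  congr 1
  ext
  simp

lemma integrable_exp_mul_sq_gaussianReal {v w : ℝ≥0} (hvw : v ≤ w) {c : ℝ} (hc : 0 ≤ c)
    (hcw : c * w < 1 / 2) : Integrable (fun x => Real.exp (c * x ^ 2)) (gaussianReal 0 v) := by
  rw [gaussianReal_eq_map_sqrt_mul,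
    integrable_map_measure (by fun_prop) (by fun_prop)]
  have hv : c * v < 1 / 2 := lt_of_le_of_lt (by gcongr) hcw
  refine (integrable_exp_mul_sq_gaussianReal_one hv).congr (Filter.Eventually.of_forall fun x => ?_)
  simp only [Function.comp, mul_pow, Real.sq_sqrt (NNReal.coe_nonneg v), mul_assoc]

lemma integral_exp_mul_sq_gaussianReal_mono {v w : ℝ≥0} (hvw : v ≤ w) {c : ℝ} (hc : 0 ≤ c)
    (hcw : c * w < 1 / 2) :
    ∫ x, Real.exp (c * x ^ 2) ∂(gaussianReal 0 v) ≤
      ∫ x, Real.exp (c * x ^ 2) ∂(gaussianReal 0 w) := by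
  have hv : c * v < 1 / 2 := lt_of_le_of_lt (by gcongr) hcw
  have key : ∀ u : ℝ≥0, ∫ x, Real.exp (c * x ^ 2) ∂(gaussianReal 0 u) =
      ∫ x, Real.exp (c * u * x ^ 2) ∂(gaussianReal 0 1) := by
    intro u
    rw [gaussianReal_eq_map_sqrt_mul, integral_map (by fun_prop) (by fun_prop)]
    simp only [mul_pow, Real.sq_sqrt (NNReal.coe_nonneg u), mul_assoc]
  rw [key, key]
  refine integral_mono (integrable_exp_mul_sq_gaussianReal_one hv)
    (integrable_exp_mul_sq_gaussianReal_one hcw) fun x => ?_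
  simp only
  gcongr

end GaussianMoments

section RiemannSum

lemma tendsto_mean_intervalIntegral {f : ℝ → ℝ} (hf : Continuous f) :
    Filter.Tendsto (fun n : ℕ => mean fun i : Fin (n + 1) => f (((i : ℝ) + 1) / (n + 1)))
      Filter.atTop (nhds (∫ x in (0 : ℝ)..1, f x)) := by
  rw [Metric.tendsto_atTop]
  intro ε hε
  have huc := isCompact_Icc.uniformContinuousOn_of_continuous (hf.continuousOn (s := Set.Icc 0 1))
  rw [Metric.uniformContinuousOn_iff] at huc
  obtain ⟨δ, hδ, h⟩ := huc (ε / 2) (half_pos hε)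
  obtain ⟨m, hm⟩ := exists_nat_one_div_lt hδ
  refine ⟨m, fun n hn => ?_⟩
  have hn0 : (0 : ℝ) < n + 1 := by positivity
  have hnδ : 1 / ((n : ℝ) + 1) < δ := by
    refine lt_of_le_of_lt ?_ hm
    gcongr
  set a : ℕ → ℝ := fun k => (k : ℝ) / (n + 1) with ha
  have hak : ∀ k, a (k + 1) - a k = 1 / ((n : ℝ) + 1) := by
    intro k
    simp only [ha]
    push_cast
    ring
  have hint : ∀ u v, IntervalIntegrable f volume u v := fun u v => hf.intervalIntegrable u v
  have hsum : ∫ x in (0 : ℝ)..1, f x = ∑ k ∈ Finset.range (n + 1), ∫ x in a k..a (k + 1), f x := by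
    rw [intervalIntegral.sum_integral_adjacent_intervals fun k _ => hint _ _]
    simp only [ha]
    push_cast
    rw [zero_div, div_self hn0.ne']
  have hmean : (mean fun i : Fin (n + 1) => f (((i : ℝ) + 1) / (n + 1))) =
      ∑ k ∈ Finset.range (n + 1), ∫ x in a k..a (k + 1), f (a (k + 1)) := by
    rw [mean, Fin.sum_univ_eq_sum_range (fun k => f (((k : ℝ) + 1) / (n + 1))), Finset.sum_div]
    refine Finset.sum_congr rfl fun k _ => ?_
    rw [intervalIntegral.integral_const, hak]
    simp only [ha, Fintype.card_fin, smul_eq_mul]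
    push_cast
    ring
  rw [hsum, hmean, Real.dist_eq, ← Finset.sum_sub_distrib]
  refine lt_of_le_of_lt (Finset.abs_sum_le_sum_abs _ _) ?_
  calc _ ≤ ∑ k ∈ Finset.range (n + 1), ε / 2 * (1 / ((n : ℝ) + 1)) := by
        refine Finset.sum_le_sum fun k hk => ?_
        rw [← intervalIntegral.integral_sub (by simp) (hint _ _)]
        have hle : a k ≤ a (k + 1) := by
          have := hak k
          have : 0 < 1 / ((n : ℝ) + 1) := by positivity
          linarith
        have hk1 : a (k + 1) ≤ 1 := by
          simp only [ha]
          rw [div_le_one hn0]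
          exact_mod_cast Finset.mem_range.1 hk
        have hk0 : 0 ≤ a k := by positivity
        have := intervalIntegral.norm_integral_le_of_norm_le_const (a := a k) (b := a (k + 1))
          (C := ε / 2) (f := fun x => f (a (k + 1)) - f x) fun x hx => ?_
        · rwa [hak, abs_of_pos (by positivity)] at this
        · rw [Set.uIoc_of_le hle] at hx
          refine (h _ ⟨hk0.trans hle, hk1⟩ x ⟨hk0.trans hx.1.le, hx.2.trans hk1⟩ ?_).le
          rw [Real.dist_eq, abs_of_nonneg (by linarith [hx.2])]
          linarith [hak k, hx.1]
    _ = ε / 2 := by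
        rw [Finset.sum_const, Finset.card_range, nsmul_eq_mul]
        push_cast
        field_simp
    _ < ε := half_lt_self hε

end RiemannSum

section Discretization

/-- The grid points `(i + 1) / (n + 1)` of the unit interval. -/
noncomputable def gridFraction (n : ℕ) (i : Fin (n + 1)) : ℝ := ((i : ℝ) + 1) / (n + 1)

lemma gridFraction_pos (n : ℕ) (i : Fin (n + 1)) : 0 < gridFraction n i := by
  unfold gridFraction
  positivity

lemma gridFraction_le_one (n : ℕ) (i : Fin (n + 1)) : gridFraction n i ≤ 1 := by
  unfold gridFraction
  rw [div_le_one (by positivity)]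
  exact_mod_cast i.isLt

/-- Right endpoints matter: they make every fraction positive and the mean `(n + 2) / (2 (n + 1))`,
above `1/2` for every `n`. -/
lemma half_le_mean_gridFraction (n : ℕ) : 1 / 2 ≤ mean (gridFraction n) := by
  have hsum : ∀ m : ℕ, ∑ k ∈ Finset.range m, ((k : ℝ) + 1) = m * (m + 1) / 2 := by
    intro m
    induction m with
    | zero => simp
    | succ m ih => rw [Finset.sum_range_succ, ih]; push_cast; ring
  have h : mean (gridFraction n) = ((n : ℝ) + 2) / (2 * (n + 1)) := by
    unfold mean gridFraction
    rw [← Finset.sum_div, Fin.sum_univ_eq_sum_range (fun k => (k : ℝ) + 1), hsum,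
      Fintype.card_fin]
    push_cast
    field_simp
    ring
  rw [h, div_le_div_iff₀ (by norm_num) (by positivity)]
  linarith

/-- The grid points `(i + 1) T / (n + 1)` of `[0, T]`. -/
noncomputable def gridTime (T : ℝ) (n : ℕ) (i : Fin (n + 1)) : ℝ≥0 := (gridFraction n i * T).toNNReal

lemma coe_gridTime {T : ℝ} (hT : 0 < T) (n : ℕ) (i : Fin (n + 1)) :
    (gridTime T n i : ℝ) = gridFraction n i * T :=
  Real.coe_toNNReal _ (mul_pos (gridFraction_pos n i) hT).le

lemma gridTime_le {T : ℝ} (hT : 0 < T) (n : ℕ) (i : Fin (n + 1)) :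
    gridTime T n i ≤ T.toNNReal :=
  Real.toNNReal_le_toNNReal (mul_le_of_le_one_left hT.le (gridFraction_le_one n i))

variable {Ω : Type*}

/-- The average of the stock price over the grid `gridTime T n`. -/
noncomputable def gridAvgPrice (B : ℝ≥0 → Ω → ℝ) (r σ T : ℝ) (n : ℕ) (ω : Ω) : ℝ :=
  mean fun i : Fin (n + 1) => stockPrice B r σ (gridTime T n i) ω

lemma tendsto_gridAvgPrice {B : ℝ≥0 → Ω → ℝ} {ω : Ω} (hω : Continuous fun t => B t ω)
    (r σ : ℝ) {T : ℝ} (hT : 0 < T) :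
    Filter.Tendsto (fun n => gridAvgPrice B r σ T n ω) Filter.atTop
      (nhds (avgPrice B r σ T ω)) := by
  have hf : Continuous fun x : ℝ => stockPrice B r σ (x * T).toNNReal ω := by
    unfold stockPrice
    have h1 : Continuous fun x : ℝ => (x * T).toNNReal := by fun_prop
    have h2 : Continuous fun x : ℝ => B (x * T).toNNReal ω := hω.comp h1
    fun_prop
  have h := tendsto_mean_intervalIntegral hf
  rw [intervalIntegral.integral_comp_mul_right
    (fun u => stockPrice B r σ u.toNNReal ω) hT.ne', zero_mul, one_mul, smul_eq_mul,
    ← one_div] at h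
  exact h

/-- The value at the grid points of the Brownian bridge on `[0, T]`. -/
noncomputable def gridBridge (B : ℝ≥0 → Ω → ℝ) (T : ℝ) (n : ℕ) (ω : Ω) (i : Fin (n + 1)) : ℝ :=
  B (gridTime T n i) ω - gridFraction n i * B T.toNNReal ω

lemma stockPrice_gridTime_eq (B : ℝ≥0 → Ω → ℝ) (r σ T : ℝ) (n : ℕ) (ω : Ω) (i : Fin (n + 1)) :
    stockPrice B r σ (gridTime T n i) ω =
      Real.exp (shiftExponent σ (fun i => (r - σ ^ 2 / 2) * gridTime T n i) (gridFraction n)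
        (B T.toNNReal ω) (gridBridge B T n ω) i) := by
  simp [stockPrice, shiftExponent, gridBridge]

variable [MeasurableSpace Ω] {Q : Measure Ω} {B : ℝ≥0 → Ω → ℝ}

lemma aemeasurable_gridAvgPrice (hB : IsBrownianReal B Q) (r σ T : ℝ) (n : ℕ) :
    AEMeasurable (gridAvgPrice B r σ T n) Q := by
  have := fun t => hB.toIsPreBrownianReal.aemeasurable t
  unfold gridAvgPrice mean stockPrice
  fun_prop

lemma aemeasurable_avgPrice (hB : IsBrownianReal B Q) (r σ : ℝ) {T : ℝ} (hT : 0 < T) :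
    AEMeasurable (avgPrice B r σ T) Q := by
  refine aemeasurable_of_tendsto_metrizable_ae Filter.atTop
    (aemeasurable_gridAvgPrice hB r σ T) ?_
  filter_upwards [hB.cont] with ω hω using tendsto_gridAvgPrice hω r σ hT

lemma exists_integral_exp_mul_sq_le (hB : IsPreBrownianReal B Q) {σ d : ℝ} {w : ℝ≥0} (hσ : 0 < σ)
    (hd : 0 < d) (hdw : d * σ ^ 2 * w < 1 / 2) (a : ℝ) :
    ∃ M : ℝ, ∀ t ≤ w, Integrable (fun ω => Real.exp (d * (a * t + σ * B t ω) ^ 2)) Q ∧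
      ∫ ω, Real.exp (d * (a * t + σ * B t ω) ^ 2) ∂Q ≤ M := by
  -- The slack `d < d'` absorbs the drift `a * t` into the constant `exp E`; the remaining Gaussian
  -- moment increases with the variance, so `t = w` is the worst case.
  obtain ⟨d', hdd', hd'w⟩ : ∃ d', d < d' ∧ d' * σ ^ 2 * w < 1 / 2 := by
    rcases eq_or_ne w 0 with rfl | hw
    · exact ⟨d + 1, by linarith, by simp⟩
    · have hw0 : (0 : ℝ) < w := NNReal.coe_pos.2 (pos_iff_ne_zero.2 hw)
      obtain ⟨d', h1, h2⟩ := exists_between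
        (show d < 1 / 2 / (σ ^ 2 * w) by rwa [lt_div_iff₀ (by positivity), ← mul_assoc])
      rw [lt_div_iff₀ (by positivity), ← mul_assoc] at h2
      exact ⟨d', h1, h2⟩
  have hd'0 : 0 < d' := hd.trans hdd'
  set E := d * d' / (d' - d) * (a * w) ^ 2 with hE
  refine ⟨Real.exp E * ∫ x, Real.exp (d' * σ ^ 2 * x ^ 2) ∂(gaussianReal 0 w), fun t ht => ?_⟩
  have hlaw := hB.hasLaw_eval t
  have hBm := hB.aemeasurable t
  have hle : ∀ ω, Real.exp (d * (a * t + σ * B t ω) ^ 2) ≤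
      Real.exp E * Real.exp (d' * σ ^ 2 * B t ω ^ 2) := by
    intro ω
    rw [← Real.exp_add, Real.exp_le_exp]
    have h1 := mul_add_sq_le hdd' (σ * B t ω) (a * t)
    have h2 : d * d' / (d' - d) * (a * t) ^ 2 ≤ E := by
      have : 0 < d' - d := sub_pos.2 hdd'
      rw [hE, mul_pow, mul_pow]
      gcongr
    rw [add_comm (a * _)]
    linarith [mul_pow σ (B t ω) 2]
  have hint : Integrable (fun ω => Real.exp (d' * σ ^ 2 * B t ω ^ 2)) Q := by
    have := integrable_exp_mul_sq_gaussianReal ht (c := d' * σ ^ 2) (by positivity) hd'w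
    rw [← hlaw.map_eq] at this
    exact (integrable_map_measure (by fun_prop) hBm).1 this
  have hint2 : Integrable (fun ω => Real.exp (d * (a * t + σ * B t ω) ^ 2)) Q := by
    refine (hint.const_mul (Real.exp E)).mono' (by fun_prop) (Filter.Eventually.of_forall fun ω => ?_)
    rw [Real.norm_eq_abs, Real.abs_exp]
    exact hle ω
  refine ⟨hint2, (integral_mono hint2 (hint.const_mul _) hle).trans ?_⟩
  rw [integral_const_mul]
  gcongr
  have := hlaw.integral_comp (f := fun x => Real.exp (d' * σ ^ 2 * x ^ 2)) (by fun_prop)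
  simp only [Function.comp_def] at this
  rw [this]
  exact integral_exp_mul_sq_gaussianReal_mono ht (by positivity) hd'w

/-- If the limit lies in an open set, so do all late terms; continuity from below then gives the
bound. -/
lemma measure_mem_le_of_tendsto_of_isOpen {A : Ω → ℝ} {a : ℕ → Ω → ℝ}
    (h : ∀ᵐ ω ∂Q, Filter.Tendsto (fun n => a n ω) Filter.atTop (nhds (A ω))) {U : Set ℝ}
    (hU : IsOpen U) {M : ℝ≥0∞} (hM : ∀ n, Q {ω | a n ω ∈ U} ≤ M) : Q {ω | A ω ∈ U} ≤ M := by
  set E : ℕ → Set Ω := fun m => {ω | ∀ n, m ≤ n → a n ω ∈ U} with hE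
  have hmono : Monotone E := fun m m' hmm' ω hω n hn => hω n (hmm'.trans hn)
  calc Q {ω | A ω ∈ U} ≤ Q (⋃ m, E m) := by
        refine measure_mono_ae ?_
        filter_upwards [h] with ω hω hωU
        obtain ⟨m, hm⟩ := Filter.eventually_atTop.1 (hω.eventually (hU.mem_nhds hωU))
        exact Set.mem_iUnion.2 ⟨m, hm⟩
    _ = ⨆ m, Q (E m) := hmono.measure_iUnion
    _ ≤ M := iSup_le fun m => (measure_mono fun ω (hω : ω ∈ E m) => hω m le_rfl).trans (hM m)

variable [IsProbabilityMeasure Q]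

/-- The two are jointly Gaussian, being linear in finitely many values of `B`, and their covariance
is `min t T - (t/T) T = 0`. -/
lemma indepFun_gridBridge (hB : IsPreBrownianReal B Q) {T : ℝ} (hT : 0 < T) (n : ℕ) :
    IndepFun (B T.toNNReal) (gridBridge B T n) Q := by
  have hm := fun t => hB.aemeasurable t
  have hL2 : ∀ t, MemLp (B t) 2 Q := fun t =>
    (hB.isGaussianProcess.hasGaussianLaw_eval t).memLp_two
  have h : IndepFun (fun ω (_ : Unit) => B T.toNNReal ω)
      (fun ω (i : Fin (n + 1)) => gridBridge B T n ω i) Q := by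
    refine IsGaussianProcess.indepFun_of_covariance_eq_zero (X := fun _ => B T.toNNReal)
      (Y := fun i ω => gridBridge B T n ω i) ?_ (fun _ => hm _) (fun i => ?_) fun _ i => ?_
    · refine hB.isGaussianProcess.of_isGaussianProcess ?_
      rintro (_ | i)
      · exact ⟨{T.toNNReal},
          { toFun x := x ⟨T.toNNReal, by simp⟩
            map_add' x y := by simp
            map_smul' c x := by simp }, by simp⟩
      · exact ⟨{gridTime T n i, T.toNNReal},
          { toFun x := x ⟨gridTime T n i, by simp⟩ - gridFraction n i * x ⟨T.toNNReal, by simp⟩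
            map_add' x y := by simp; ring
            map_smul' c x := by simp; ring }, by simp [gridBridge]⟩
    · unfold gridBridge
      fun_prop
    · unfold gridBridge
      rw [covariance_fun_sub_right (hL2 _) (hL2 _) ((hL2 _).const_mul _),
        covariance_const_mul_right, hB.covariance_eval, hB.covariance_fun_eval, min_self,
        min_eq_right (gridTime_le hT n i), coe_gridTime hT, Real.coe_toNNReal _ hT.le, sub_self]
  exact h.comp (φ := fun x => x ()) (ψ := fun y => y) (measurable_pi_apply (X := fun _ : Unit => ℝ) ())
    measurable_id

lemma exists_measure_gridAvgPrice_le (hB : IsBrownianReal B Q) (r : ℝ) {σ T : ℝ}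
    (hσ : 0 < σ) (hT : 0 < T) {c : ℝ} (hc : 0 < c) (hc' : c < 1 / (2 * σ ^ 2 * T)) :
    ∃ C : ℝ, 0 ≤ C ∧ ∀ (n : ℕ) (S : Set ℝ), MeasurableSet S →
      Q {ω | gridAvgPrice B r σ T n ω ∈ S} ≤ logGaussianMeasure C c S := by
  obtain ⟨d, hcd, hd⟩ := exists_between hc'
  have hd0 : 0 < d := hc.trans hcd
  have hτ : ((T.toNNReal : ℝ≥0) : ℝ) = T := Real.coe_toNNReal _ hT.le
  have hτ0 : T.toNNReal ≠ 0 := (Real.toNNReal_pos.2 hT).ne'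
  -- This is the exponential-square moment condition, and the origin of the threshold `1 / (2σ²T)`.
  have hdT : d * σ ^ 2 * (T.toNNReal : ℝ≥0) < 1 / 2 := by
    rw [lt_div_iff₀ (by positivity)] at hd
    rw [hτ]
    linarith
  obtain ⟨C, hC, hbound⟩ := exists_exp_div_mean_le hσ hT hc hcd
  obtain ⟨M, hM⟩ := exists_integral_exp_mul_sq_le hB.toIsPreBrownianReal hσ hd0 hdT
    (r - σ ^ 2 / 2)
  obtain ⟨M', hM'⟩ := exists_integral_exp_mul_sq_le hB.toIsPreBrownianReal hσ hd0 hdT 0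
  have hM0 : 0 ≤ M := (integral_nonneg fun ω => (Real.exp_pos _).le).trans (hM _ le_rfl).2
  have hM'0 : 0 ≤ M' := (integral_nonneg fun ω => (Real.exp_pos _).le).trans (hM' _ le_rfl).2
  refine ⟨Real.exp σ * (C * (1 + M + M')), by positivity, fun n S hS => ?_⟩
  have hm := fun t => hB.toIsPreBrownianReal.aemeasurable t
  have hβm : AEMeasurable (gridBridge B T n) Q := by
    unfold gridBridge
    exact aemeasurable_pi_lambda _ fun i => by fun_prop
  set X : Ω → Fin (n + 1) → ℝ := fun ω =>
    shiftExponent σ (fun i => (r - σ ^ 2 / 2) * gridTime T n i) (gridFraction n)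
        (B T.toNNReal ω) (gridBridge B T n ω) with hX
  have hXeq : ∀ ω i, X ω i = (r - σ ^ 2 / 2) * gridTime T n i + σ * B (gridTime T n i) ω := by
    intro ω i
    simp [hX, shiftExponent, gridBridge]
  have hA : ∀ ω, gridAvgPrice B r σ T n ω = mean fun i => Real.exp (X ω i) := fun ω => by
    simp only [gridAvgPrice, stockPrice_gridTime_eq, hX]
  set W : Ω → ℝ := fun ω =>
    1 + (mean fun i => Real.exp (d * X ω i ^ 2)) + Real.exp (d * σ ^ 2 * B T.toNNReal ω ^ 2) with hW
  have hW0 : ∀ ω, 0 ≤ W ω := fun ω =>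
    add_nonneg (add_nonneg zero_le_one (mean_nonneg fun i => (Real.exp_pos _).le))
      (Real.exp_pos _).le
  have hiX : ∀ i, Integrable (fun ω => Real.exp (d * X ω i ^ 2)) Q := fun i => by
    simpa only [hXeq] using (hM _ (gridTime_le hT n i)).1
  have hsq : ∀ ω, d * σ ^ 2 * B T.toNNReal ω ^ 2 =
      d * (0 * (T.toNNReal : ℝ≥0) + σ * B T.toNNReal ω) ^ 2 := fun ω => by ring
  have hiZ : Integrable (fun ω => Real.exp (d * σ ^ 2 * B T.toNNReal ω ^ 2)) Q := by
    simpa only [hsq] using (hM' _ le_rfl).1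
  have himean : Integrable (fun ω => mean fun i => Real.exp (d * X ω i ^ 2)) Q :=
    (integrable_finsetSum _ fun i _ => hiX i).div_const _
  have hi1 : Integrable (fun ω => 1 + mean fun i => Real.exp (d * X ω i ^ 2)) Q :=
    (integrable_const 1).add himean
  have hiW : Integrable W Q := hi1.add hiZ
  have hEW : ∫ ω, W ω ∂Q ≤ 1 + M + M' := by
    simp only [hW]
    rw [integral_add hi1 hiZ, integral_add (integrable_const 1) himean]
    have h1 : ∫ ω, (mean fun i => Real.exp (d * X ω i ^ 2)) ∂Q ≤ M := by
      simp only [mean]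
      rw [integral_div, integral_finsetSum _ fun i _ => hiX i]
      calc _ = mean fun i => ∫ ω, Real.exp (d * X ω i ^ 2) ∂Q := rfl
        _ ≤ mean fun _ : Fin (n + 1) => M := mean_mono fun i => by
            simpa only [hXeq] using (hM _ (gridTime_le hT n i)).2
        _ = M := mean_const M
    have h2 : ∫ ω, Real.exp (d * σ ^ 2 * B T.toNNReal ω ^ 2) ∂Q ≤ M' := by
      simpa only [hsq] using (hM' _ le_rfl).2
    simp only [integral_const, probReal_univ, smul_eq_mul, mul_one]
    linarith
  have hker := measure_mean_exp_shiftExponent_le (α := fun i => (r - σ ^ 2 / 2) * gridTime T n i)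
    hτ0 hσ (gridFraction_pos n) (gridFraction_le_one n)
    (hB.toIsPreBrownianReal.hasLaw_eval T.toNNReal) hβm
    (indepFun_gridBridge hB.toIsPreBrownianReal hT n) hS
  simp only [hA]
  refine hker.trans ?_
  rw [logGaussianMeasure, withDensity_apply _ hS, Measure.restrict_restrict hS,
    ← lintegral_const_mul' _ _ ENNReal.ofReal_ne_top]
  refine setLIntegral_mono' (hS.inter measurableSet_Ioi) fun x hx => ?_
  have hx0 : 0 < x := hx.2
  rw [mul_assoc, ENNReal.ofReal_mul (Real.exp_pos σ).le]
  gcongr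
  calc _ ≤ ∫⁻ ω, ENNReal.ofReal (C * Real.exp (-c * Real.log x ^ 2) * W ω) ∂Q := by
        refine lintegral_mono (Set.indicator_le fun ω hω => ?_)
        refine ENNReal.ofReal_le_ofReal ?_
        rw [hτ]
        exact hbound (gridFraction n) (X ω) (B T.toNNReal ω) x (gridFraction_pos n)
          (gridFraction_le_one n) (half_le_mean_gridFraction n) hx0 hω.1 hω.2
    _ = ENNReal.ofReal (∫ ω, C * Real.exp (-c * Real.log x ^ 2) * W ω ∂Q) :=
        (ofReal_integral_eq_lintegral_ofReal (hiW.const_mul _)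
          (Filter.Eventually.of_forall fun ω => mul_nonneg (by positivity) (hW0 ω))).symm
    _ ≤ _ := by
        refine ENNReal.ofReal_le_ofReal ?_
        rw [integral_const_mul, mul_right_comm]
        gcongr

lemma exists_map_avgPrice_le (hB : IsBrownianReal B Q) (r : ℝ) {σ T : ℝ}
    (hσ : 0 < σ) (hT : 0 < T) {c : ℝ} (hc : 0 < c) (hc' : c < 1 / (2 * σ ^ 2 * T)) :
    ∃ C : ℝ, 0 ≤ C ∧ Q.map (avgPrice B r σ T) ≤ logGaussianMeasure C c := by
  obtain ⟨C, hC, h⟩ := exists_measure_gridAvgPrice_le hB r hσ hT hc hc'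
  refine ⟨C, hC, ?_⟩
  have := isFiniteMeasure_logGaussianMeasure C hc
  refine Measure.le_intro fun S hS _ => ?_
  -- Only open sets pass to the limit; outer regularity of the finite dominating measure reaches
  -- every measurable set.
  rw [S.measure_eq_iInf_isOpen (logGaussianMeasure C c)]
  refine le_iInf₂ fun U hSU => le_iInf fun hU => (measure_mono hSU).trans ?_
  rw [Measure.map_apply_of_aemeasurable (aemeasurable_avgPrice hB r σ hT) hU.measurableSet]
  exact measure_mem_le_of_tendsto_of_isOpen
    (hB.cont.mono fun ω hω => tendsto_gridAvgPrice hω r σ hT) hU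
    fun n => h n U hU.measurableSet

end Discretization

end AsianOption

theorem proposition5 {Ω : Type*} [MeasurableSpace Ω] (Q : Measure Ω) [IsProbabilityMeasure Q]
    (B : ℝ≥0 → Ω → ℝ) (hB : IsBrownianReal B Q)
    (r σ T K μ ν : ℝ) (hσ : 0 < σ) (hT : 0 < T) (hK : 0 < K) (hν : 0 < ν)
    (N : ℕ) (b : Fin (N + 1) → Polynomial ℝ)
    (hb : AsianOption.IsOrthonormalPolyBasis μ ν N b) :
    HasPDF (AsianOption.avgPrice B r σ T) Q volume ∧
    Integrable (fun ω => max (AsianOption.avgPrice B r σ T ω - K) 0) Q ∧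
    AsianOption.MemL2w μ ν (AsianOption.payoff r T K) ∧
    (σ ^ 2 * T / 2 < ν ^ 2 →
      AsianOption.MemL2w μ ν (AsianOption.likelihood Q B r σ T μ ν) ∧
      AsianOption.projError μ ν b (AsianOption.payoff r T K) < ∞ ∧
      AsianOption.projError μ ν b (AsianOption.likelihood Q B r σ T μ ν) < ∞) ∧
    ENNReal.ofReal |AsianOption.price Q B r σ T K -
        AsianOption.truncatedPrice Q B r σ T K μ ν b| ≤
      (AsianOption.projError μ ν b (AsianOption.payoff r T K) *
        AsianOption.projError μ ν b (AsianOption.likelihood Q B r σ T μ ν)) ^ (1 / 2 : ℝ) := by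
  have hA := AsianOption.aemeasurable_avgPrice hB r σ hT
  have hlaw := fun c hc hc' => AsianOption.exists_map_avgPrice_le hB r hσ hT (c := c) hc hc'
  have hc₀ : 0 < 1 / (4 * σ ^ 2 * T) := by positivity
  -- Any admissible `c` serves for the density and integrability; half the threshold is taken, with
  -- no condition on `ν`.
  obtain ⟨C, hC, hle⟩ := hlaw (1 / (4 * σ ^ 2 * T)) hc₀ (by gcongr; norm_num)
  have hpdf := AsianOption.hasPDF_of_map_le hA hle
  have hFm := AsianOption.measurable_payoff r T K
  have hlm := AsianOption.measurable_likelihood Q B r σ T μ ν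
  have hF := AsianOption.memLp_payoff r T hK μ hν
  refine ⟨hpdf, ?_, ⟨hFm, (AsianOption.wNormSq_lt_top_iff μ ν hFm).2 hF⟩, fun h => ?_,
    AsianOption.ofReal_abs_price_sub_truncatedPrice_le hK hν hb⟩
  · exact ((AsianOption.integrable_of_map_le hA hC hc₀ hle).sub (integrable_const K)).pos_part
  · obtain ⟨c, hc1, hc2⟩ := exists_between (show 1 / (4 * ν ^ 2) < 1 / (2 * σ ^ 2 * T) by
      gcongr 1 / ?_
      linarith)
    have hc : 0 < c := lt_trans (by positivity) hc1
    obtain ⟨C, hC, hle⟩ := hlaw c hc hc2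
    have hl := AsianOption.wNormSq_pdf_div_weight_lt_top hA μ hC hν hc1 hle
    exact ⟨⟨hlm, hl⟩, (AsianOption.projError_lt_top_iff b hν hFm).2 hF,
      (AsianOption.projError_lt_top_iff b hν hlm).2
        ((AsianOption.wNormSq_lt_top_iff μ ν hlm).1 hl)⟩
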